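/- **Setting.** Let $S$ be a finite dimensional complex manifold with sheaf $\mathcal O$ of holomorphic functions. A *metric* on a sheaf $\mathcal F\to S$ of $\mathcal O$-modules is a morphism $p$ of sheaves of sets from $\mathcal F$ to the sheaf of nonnegative continuous functions such that $p(\varphi+\psi)\le p(\varphi)+p(\psi)$, $p(f\varphi)=|f|\,p(\varphi)$ for $f\in\mathcal O$, and $p(\varphi)=0$ if and only if $\varphi=0$. For $s\in S$ let $\mathcal J(s)\subset\mathcal O$ be the subsheaf of germs vanishing at $s$ and $\mathcal F^s=\mathcal F_s/(\mathcal J(s)\mathcal F)_s$; $p$ induces a seminorm $p^s$ on $\mathcal F^s$, the value $p(\varphi)(s)$ at any representative $\varphi$. For a real function $u$ continuous near $z_0\in\mathbb C$ put $$\Lambda u(z_0)=\limsup_{r\to0}r^{-2}\Big(\int_0^1u(z_0+re^{2\pi i\tau})\,d\tau-u(z_0)\Big).$$ For a real function $u$ continuous near $s\in S$ and $\xi\in T^{1,0}_sS$ let $\xi\bar\xi u\in[-\infty,\infty]$ be the infimum of $\Lambda(u\circ f)(0)$ over holomorphic maps $f$ from a neighborhood of $0\in\mathbb C$ to $S$ that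 map $\partial/\partial z$ at $0$ to $\xi$. The *Griffiths curvature* of $(\mathcal F,p)$ is defined, for $\xi\in T^{1,0}_sS$ and $v\in\mathcal F^s$ with $p^s(v)\neq0$, by $$-K_\xi(v)=2\inf\{\xi\bar\xi\log p(\varphi)(s):\varphi\in v\}\in[-\infty,\infty].$$ Let $\mathcal F,\mathcal F'\to S$ be sheaves of $\mathcal O$-modules with metrics $p,p'$. For open $U\subset S$ and a homomorphism $\alpha:\mathcal F|U\to\mathcal F'|U$ of sheaves of $\mathcal O$-modules let $$\|\alpha\|(s)=\inf\{a\in[0,\infty):p'(\alpha\varphi)(s)\le a\,p(\varphi)(s)\text{ for all }\varphi\in\mathcal F_s\}\in[0,\infty],\qquad s\in U,$$ and let $\mathcal H=\mathbf{Hom}((\mathcal F,p),(\mathcal F',p'))$ be the sheaf of germs of those $\alpha$ for which $\|\alpha\|$ is finite and continuous. Its Griffiths curvature with respect to $\|\cdot\|$ is defined by the same formula, for the classes $v$ in $\mathcal H^s$ of germs $\alpha\in\mathcal H_s$ with $\|\alpha\|(s)\ne0$; here $\alpha,\beta\in\mathcal H_s$ are in the same class if $\alpha-\beta$ is a finite sum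 $\sum_jf_j\gamma_j$ with $f_j\in\mathcal J(s)_s$ and $\gamma_j\in\mathcal H_s$. **Corollary 2.5.** Suppose that $(\mathcal F,p)$ is the sheaf of holomorphic sections of a holomorphic Hilbert bundle over $S$ with a (positive definite) hermitian metric $h$ of class $C^2$, $p(\varphi)=h(\varphi,\varphi)^{1/2}$, and that $\mathcal F'$ is any sheaf of $\mathcal O$-modules with a metric $p'$. Let $K,K'$ be the Griffiths curvatures of $(\mathcal F,p)$, $(\mathcal F',p')$. Suppose that for all $s\in S$ and $\xi\in T^{1,0}_sS$ $$\inf\{K_\xi(v):v\in\mathcal F^s,\ p^s(v)\neq0\}\ \ge\ \sup\{K'_\xi(v'):v'\in\mathcal F'^s,\ p'^s(v')\ne0\}$$ (with $\inf\emptyset=+\infty$, $\sup\emptyset=-\infty$). Then the metric $\|\cdot\|$ on $\mathbf{Hom}((\mathcal F,p),(\mathcal F',p'))$ has seminegative Griffiths curvature: for all $s\in S$, $\xi\in T^{1,0}_sS$ and every class $v\in\mathcal H^s$ of a germ $\alpha$ with $\|\alpha\|(s)\neq0$, the curvature at $v$ in the direction $\xi$ is $\le0$. -/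

import Mathlib

open CategoryTheory TopologicalSpace Opposite Manifold Filter
open scoped ContDiff NNReal ENNReal Topology

noncomputable section

/-! ## The structure sheaf, and sheaves of modules over it -/

section StructureSheaf

variable (E : Type*) [NormedAddCommGroup E] [NormedSpace ℂ E]
  (S : Type) [TopologicalSpace S] [ChartedSpace E S]

/-- The sheaf `𝒪` of holomorphic functions on the complex manifold `S` modelled on `E`
(over `ℂ`, maps of class `C^∞` in the sense of complex derivatives are the holomorphic maps). -/
abbrev holoSheaf : TopCat.Sheaf RingCat.{0} (TopCat.of S) :=
  smoothSheafRing 𝓘(ℂ, E) 𝓘(ℂ) S ℂ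

/-- The ring `𝒪(U)` of holomorphic functions on `U`. -/
abbrev HolRing (U : Opens S) : Type := (holoSheaf E S).obj.obj (op U)

/-- The stalk `𝒪_s`. -/
abbrev HolStalk (s : S) : RingCat.{0} :=
  TopCat.Presheaf.stalk (X := TopCat.of S) (C := RingCat.{0}) (holoSheaf E S).obj s

/-- Presheaves of `𝒪`-modules. -/
abbrev HolPresheafMod : Type _ := PresheafOfModules.{0} (holoSheaf E S).obj

/-- Sheaves of `𝒪`-modules. -/
abbrev HolSheafMod : Type _ := SheafOfModules.{0} (holoSheaf E S)

variable {E S}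

/-- An element of `𝒪(U)` as a function on `U`. -/
def HolRing.toMap {U : Opens S} (f : HolRing E S U) : C^∞⟮𝓘(ℂ, E), U; 𝓘(ℂ), ℂ⟯ := f

theorem HolRing.mul_comm {U : Opens S} (f g : HolRing E S U) : f * g = g * f :=
  _root_.mul_comm (G := C^∞⟮𝓘(ℂ, E), U; 𝓘(ℂ), ℂ⟯) f g

/-- Restriction of holomorphic functions. -/
def HolRing.res {U V : Opens S} (h : V ≤ U) : HolRing E S U →+* HolRing E S V :=
  ((holoSheaf E S).obj.map (homOfLE h).op).hom

/-- Sections over `U` of a presheaf of `𝒪`-modules. -/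
abbrev Sec (G : HolPresheafMod E S) (U : Opens S) : Type := G.obj (op U)

/-- Restriction of sections. -/
def Sec.res {G : HolPresheafMod E S} {U V : Opens S} (h : V ≤ U) :
    Sec G U →ₛₗ[HolRing.res (E := E) h] Sec G V :=
  G.restrictₛₗ (homOfLE h).op

/-- The stalk `G_s`. -/
abbrev SecStalk (G : HolPresheafMod E S) (s : S) : Ab.{0} :=
  TopCat.Presheaf.stalk (X := TopCat.of S) (C := Ab.{0}) G.presheaf s

/-- Mathlib's module structure on the stalks of a presheaf of modules. -/
abbrev stalkModule {X : TopCat.{0}} {R : X.Presheaf RingCat.{0}} (M : PresheafOfModules.{0} R)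
    (x : X) : Module (TopCat.Presheaf.stalk (C := RingCat.{0}) R x)
      (TopCat.Presheaf.stalk (C := Ab.{0}) M.presheaf x) :=
  inferInstance

instance (G : HolPresheafMod E S) (s : S) : Module (HolStalk E S s) (SecStalk G s) :=
  stalkModule (X := TopCat.of S) (R := (holoSheaf E S).obj) G s

/-- The germ at `s` of a holomorphic function. -/
def HolRing.germ {U : Opens S} (s : S) (hs : s ∈ U) (f : HolRing E S U) : HolStalk E S s :=
  TopCat.Presheaf.germ (X := TopCat.of S) (C := RingCat.{0}) (holoSheaf E S).obj U s hs f

/-- The germ at `s` of a section. -/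
def Sec.germ {G : HolPresheafMod E S} {U : Opens S} (s : S) (hs : s ∈ U) (φ : Sec G U) :
    SecStalk G s :=
  TopCat.Presheaf.germ (X := TopCat.of S) (C := Ab.{0}) G.presheaf U s hs φ

variable (E) in
/-- `𝒥(s)_s`: the germs at `s` of holomorphic functions that vanish at `s`. -/
def vanishingGerms (s : S) : Set (HolStalk E S s) :=
  {g | ∃ (U : Opens S) (hs : s ∈ U) (f : HolRing E S U), f.toMap ⟨s, hs⟩ = 0 ∧ f.germ s hs = g}

end StructureSheaf

/-! ## The pointwise Levi form -/

section Levi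

/-- `Λu(z₀) = limsup_{r → 0} r⁻² (∫₀¹ u(z₀ + r e^{2πiτ}) dτ - u(z₀))`. It is used only for
functions that are continuous near `z₀`. -/
def lambdaOp (u : ℂ → ℝ) (z₀ : ℂ) : EReal :=
  limsup (fun r : ℝ => (((r ^ 2)⁻¹ * (Real.circleAverage u z₀ r - u z₀) : ℝ) : EReal)) (𝓝[>] 0)

variable {E : Type*} [NormedAddCommGroup E] [NormedSpace ℂ E]
  {S : Type} [TopologicalSpace S] [ChartedSpace E S]

/-- `ξ ξ̄ u` at `s`: the infimum of `Λ(u ∘ f)(0)` over the holomorphic maps `f` from a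
neighbourhood of `0 ∈ ℂ` to `S` that map `∂/∂z` at `0` to `ξ ∈ T_s S` (the complex tangent space
`T_s S` of the complex manifold `S` is `T_s^{1,0} S`). -/
def leviInf (s : S) (ξ : TangentSpace 𝓘(ℂ, E) s) (u : S → ℝ) : EReal :=
  ⨅ (f : ℂ → S) (_ : ContMDiffAt 𝓘(ℂ) 𝓘(ℂ, E) ω f 0)
    (_ : (⟨f 0, mfderiv 𝓘(ℂ) 𝓘(ℂ, E) f 0 (1 : ℂ)⟩ : TangentBundle 𝓘(ℂ, E) S) = ⟨s, ξ⟩),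
    lambdaOp (u ∘ f) 0

end Levi

/-! ## Griffiths curvature -/

section Curvature

variable {E : Type*} [NormedAddCommGroup E] [NormedSpace ℂ E]
  {S : Type} [TopologicalSpace S] [ChartedSpace E S]

/-- A family of distinguished sections (`mem U φ`: the section `φ` over `U` is distinguished)
of a presheaf of `𝒪`-modules, and for every section a function that measures its size. This is the
raw material from which a curvature is computed. It is used for a sheaf of modules with a metric
(where every section is distinguished) and for the homomorphisms with continuous norm among all
homomorphisms between two sheaves. -/
structure NormedSections (G : HolPresheafMod E S) where
  /-- the distinguished sections -/
  mem : ∀ U : Opens S, Sec G U → Prop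
  /-- the size of a section -/
  size : ∀ U : Opens S, Sec G U → U → ℝ≥0∞

namespace NormedSections

variable {G : HolPresheafMod E S} (N : NormedSections G)

/-- `(𝒥(s)𝓝)_s`: the finite sums of products `f • γ`, where `f` is a germ at `s` of a holomorphic
function with `f(s) = 0` and `γ` is the germ at `s` of a distinguished section. -/
def vanishing (s : S) : Submodule (HolStalk E S s) (SecStalk G s) :=
  Submodule.span (HolStalk E S s)
    {m | ∃ f ∈ vanishingGerms E s, ∃ (U : Opens S) (hs : s ∈ U) (γ : Sec G U),
      N.mem U γ ∧ m = f • γ.germ s hs}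

/-- The class at `s` of a section. -/
def cls {U : Opens S} (s : S) (hs : s ∈ U) (φ : Sec G U) : SecStalk G s ⧸ N.vanishing s :=
  Submodule.Quotient.mk (φ.germ s hs)

/-- The fibre `𝓝^s = 𝓝_s / (𝒥(s)𝓝)_s`: the classes of the germs of distinguished sections. -/
def Fibre (s : S) : Type :=
  {v : SecStalk G s ⧸ N.vanishing s //
    ∃ (U : Opens S) (hs : s ∈ U) (φ : Sec G U), N.mem U φ ∧ N.cls s hs φ = v}

/-- The seminorm on the fibre `𝓝^s`: the size at `s` of the representatives. (For a
metric all representatives of a class have the same size at `s`.) -/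
def fibreNorm (s : S) (v : N.Fibre s) : ℝ≥0∞ :=
  ⨅ (U : Opens S) (hs : s ∈ U) (φ : Sec G U) (_ : N.mem U φ) (_ : N.cls s hs φ = v.1),
    N.size U φ ⟨s, hs⟩

/-- The logarithm of the size of a section over `U`, as a function on `S` (only its germs at
points of `U` where the size is positive and finite are significant). -/
def logSize (U : Opens S) (φ : Sec G U) : S → ℝ :=
  Function.extend Subtype.val (fun x : U => Real.log (N.size U φ x).toReal) 0

/-- The Griffiths curvature: `-K_ξ(v)` is twice the infimum, over the representatives `φ` of `v`,
of `ξ ξ̄ log(size of φ)` at `s`. It is meaningful when `fibreNorm v ≠ 0`. -/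
def griffiths (s : S) (ξ : TangentSpace 𝓘(ℂ, E) s) (v : N.Fibre s) : EReal :=
  -(2 * ⨅ (U : Opens S) (hs : s ∈ U) (φ : Sec G U) (_ : N.mem U φ) (_ : N.cls s hs φ = v.1),
    leviInf s ξ (N.logSize U φ))

/-- Seminegative Griffiths curvature: `K_ξ(v) ≤ 0` whenever it is defined. -/
def SeminegativeCurvature : Prop :=
  ∀ (s : S) (ξ : TangentSpace 𝓘(ℂ, E) s) (v : N.Fibre s),
    N.fibreNorm s v ≠ 0 → N.griffiths s ξ v ≤ 0

end NormedSections

/-- A metric on a sheaf of `𝒪`-modules: a morphism `p` to the sheaf of nonnegative continuous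
functions with `p(φ + ψ) ≤ p(φ) + p(ψ)`, `p(fφ) = |f| p(φ)`, and `p(φ) = 0` iff `φ = 0`. -/
structure SheafMetric (F : HolSheafMod E S) where
  /-- the function `p(φ)` -/
  fn : ∀ {U : Opens S}, Sec F.val U → C(U, ℝ≥0)
  fn_res : ∀ {U V : Opens S} (h : V ≤ U) (φ : Sec F.val U) (x : V),
    fn (Sec.res h φ) x = fn φ ⟨x, h x.2⟩
  fn_add : ∀ {U : Opens S} (φ ψ : Sec F.val U) (x : U), fn (φ + ψ) x ≤ fn φ x + fn ψ x
  fn_smul : ∀ {U : Opens S} (f : HolRing E S U) (φ : Sec F.val U) (x : U),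
    fn (f • φ) x = ‖f.toMap x‖₊ * fn φ x
  fn_eq_zero : ∀ {U : Opens S} (φ : Sec F.val U), fn φ = 0 ↔ φ = 0

/-- All sections of `F`, with size given by the metric. Its fibres are
`F^s = F_s / (𝒥(s)F)_s`. -/
def SheafMetric.normed {F : HolSheafMod E S} (p : SheafMetric F) : NormedSections F.val where
  mem _ _ := True
  size _ φ x := (p.fn φ x : ℝ≥0∞)

end Curvature

/-! ## The sheaf of homomorphisms and its norm -/

section Hom

variable {E : Type*} [NormedAddCommGroup E] [NormedSpace ℂ E]
  {S : Type} [TopologicalSpace S] [ChartedSpace E S]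

/-- A homomorphism `F|U → F'|U` of sheaves of `𝒪`-modules. -/
@[ext]
structure HomOn (F F' : HolSheafMod E S) (U : Opens S) where
  /-- the action on the sections over `V ⊆ U` -/
  app : ∀ V : Opens S, V ≤ U → Sec F.val V →ₗ[HolRing E S V] Sec F'.val V
  app_res : ∀ {V W : Opens S} (hV : V ≤ U) (h : W ≤ V) (φ : Sec F.val V),
    app W (h.trans hV) (Sec.res h φ) = Sec.res h (app V hV φ)

namespace HomOn

variable {F F' : HolSheafMod E S} {U : Opens S}

instance : Zero (HomOn F F' U) := ⟨⟨fun _ _ => 0, by intros; simp⟩⟩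

instance : Add (HomOn F F' U) :=
  ⟨fun α β => ⟨fun V h => α.app V h + β.app V h, fun hV h φ => by
    rw [LinearMap.add_apply, LinearMap.add_apply, map_add]
    exact congrArg₂ _ (α.app_res hV h φ) (β.app_res hV h φ)⟩⟩

instance : Neg (HomOn F F' U) :=
  ⟨fun α => ⟨fun V h => -α.app V h, fun hV h φ => by
    rw [LinearMap.neg_apply, LinearMap.neg_apply, map_neg]
    exact congrArg _ (α.app_res hV h φ)⟩⟩

/-- `(f • α)(φ) = f|V • α(φ)` for `φ` a section over `V`. -/
instance : SMul (HolRing E S U) (HomOn F F' U) :=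
  ⟨fun f α =>
    { app := fun V h =>
        { toFun := fun φ => HolRing.res h f • α.app V h φ
          map_add' := by intros; simp
          map_smul' := by
            intro g φ
            simp only [map_smul, RingHom.id_apply, smul_smul]
            rw [HolRing.mul_comm] }
      app_res := by
        intro V W hV h φ
        simp only [LinearMap.coe_mk, AddHom.coe_mk, LinearMap.map_smulₛₗ]
        exact congrArg (HolRing.res (h.trans hV) f • ·) (α.app_res hV h φ) }⟩

@[simp] theorem zero_app (V : Opens S) (h : V ≤ U) : (0 : HomOn F F' U).app V h = 0 := rfl
@[simp] theorem add_app (α β : HomOn F F' U) (V : Opens S) (h : V ≤ U) :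
    (α + β).app V h = α.app V h + β.app V h := rfl
@[simp] theorem neg_app (α : HomOn F F' U) (V : Opens S) (h : V ≤ U) :
    (-α).app V h = -α.app V h := rfl
@[simp] theorem smul_app (f : HolRing E S U) (α : HomOn F F' U) (V : Opens S) (h : V ≤ U)
    (φ : Sec F.val V) : (f • α).app V h φ = HolRing.res h f • α.app V h φ := rfl

instance : AddCommGroup (HomOn F F' U) where
  add_assoc α β γ := by ext : 3; simp [add_assoc]
  zero_add α := by ext : 3; simp
  add_zero α := by ext : 3; simp
  add_comm α β := by ext : 3; simp [add_comm]
  neg_add_cancel α := by ext : 3; simp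
  nsmul := nsmulRec
  zsmul := zsmulRec

instance : Module (HolRing E S U) (HomOn F F' U) where
  one_smul α := by ext : 4; simp
  mul_smul f g α := by ext : 4; simp [mul_smul]
  smul_zero f := by ext : 4; simp
  smul_add f α β := by ext : 4; simp
  add_smul f g α := by ext : 4; simp [add_smul]
  zero_smul α := by ext : 4; simp

/-- Restriction of a homomorphism to a smaller open set. -/
def res {V : Opens S} (h : V ≤ U) (α : HomOn F F' U) : HomOn F F' V where
  app W hW := α.app W (hW.trans h)
  app_res hV hW φ := α.app_res (hV.trans h) hW φ

end HomOn

/-- The presheaf of `𝒪`-modules `U ↦ Hom(F|U, F'|U)` (it is a sheaf). -/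
def homPresheaf (F F' : HolSheafMod E S) : HolPresheafMod E S where
  obj U := ModuleCat.of (HolRing E S U.unop) (HomOn F F' U.unop)
  map {U V} i := ModuleCat.ofHom
    (Y := (ModuleCat.restrictScalars ((holoSheaf E S).obj.map i).hom).obj
      (ModuleCat.of (HolRing E S V.unop) (HomOn F F' V.unop)))
    { toFun := fun α => α.res i.unop.le
      map_add' := fun _ _ => rfl
      map_smul' := fun _ _ => rfl }

/-- The norm `‖α‖(s) = inf {a ∈ [0,∞) : p'(αφ)(s) ≤ a p(φ)(s) for all φ ∈ F_s} ∈ [0,∞]` of a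
homomorphism `α : F|U → F'|U`. -/
def homNorm {F F' : HolSheafMod E S} (p : SheafMetric F) (p' : SheafMetric F') {U : Opens S}
    (α : HomOn F F' U) (s : U) : ℝ≥0∞ :=
  ⨅ (a : ℝ≥0) (_ : ∀ (V : Opens S) (hV : V ≤ U) (hs : s.1 ∈ V) (φ : Sec F.val V),
    p'.fn (α.app V hV φ) ⟨s, hs⟩ ≤ a * p.fn φ ⟨s, hs⟩), (a : ℝ≥0∞)

/-- The sheaf `Hom((F,p),(F',p'))` with the metric `‖ ‖`: its sections over `U` are the
homomorphisms `α : F|U → F'|U` whose norm `‖α‖ : U → [0,∞)` is finite and continuous. -/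
def homMetric {F F' : HolSheafMod E S} (p : SheafMetric F) (p' : SheafMetric F') :
    NormedSections (homPresheaf F F') where
  mem U α := (∀ x : U, homNorm p p' (U := U) α x ≠ ⊤) ∧ Continuous (homNorm p p' (U := U) α)
  size U α := homNorm p p' (U := U) α

end Hom

/-! ## Hermitian holomorphic Hilbert bundles -/

section Bundle

set_option linter.checkUnivs false in
/-- A holomorphic Hilbert bundle over the complex manifold `S`, given by its fibres, which are
complex vector spaces, and by local trivializations onto complex Hilbert spaces (which
may vary with the trivialization) over the members of an open cover of `S`. The transition
maps are holomorphic as maps into the Banach space of bounded operators. -/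
structure HolHilbertBundle.{u, v₁, v₂, v₃} (E : Type u) [NormedAddCommGroup E] [NormedSpace ℂ E]
    (S : Type) [TopologicalSpace S] [ChartedSpace E S] where
  /-- the fibres -/
  Fib : S → Type v₁
  [fibAddCommGroup : ∀ s, AddCommGroup (Fib s)]
  [fibModule : ∀ s, Module ℂ (Fib s)]
  /-- the index set of the local trivializations -/
  ι : Type v₂
  /-- the domain in `S` of a local trivialization -/
  dom : ι → Opens S
  cover : ∀ s, ∃ i, s ∈ dom i
  /-- the Hilbert space on which a local trivialization is modelled -/
  Model : ι → Type v₃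
  [modelNormedAddCommGroup : ∀ i, NormedAddCommGroup (Model i)]
  [modelInnerProductSpace : ∀ i, InnerProductSpace ℂ (Model i)]
  [modelCompleteSpace : ∀ i, CompleteSpace (Model i)]
  /-- the local trivializations -/
  triv : ∀ (i : ι) (s : dom i), Fib s ≃ₗ[ℂ] Model i
  holomorphic_transition : ∀ i j, ∃ g : S → (Model i →L[ℂ] Model j),
    ContMDiffOn 𝓘(ℂ, E) 𝓘(ℂ, Model i →L[ℂ] Model j) ω g (dom i ∩ dom j) ∧
    ∀ (s : S) (hi : s ∈ dom i) (hj : s ∈ dom j) (w : Model i),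
      g s w = triv j ⟨s, hj⟩ ((triv i ⟨s, hi⟩).symm w)

attribute [instance] HolHilbertBundle.fibAddCommGroup HolHilbertBundle.fibModule
  HolHilbertBundle.modelNormedAddCommGroup HolHilbertBundle.modelInnerProductSpace
  HolHilbertBundle.modelCompleteSpace

variable {E : Type*} [NormedAddCommGroup E] [NormedSpace ℂ E]
  {S : Type} [TopologicalSpace S] [ChartedSpace E S]

/-- A hermitian metric of class `C²` (in the real sense) on a holomorphic Hilbert bundle. In
a local trivialization it is `⟨P(s)w₁, w₂⟩`, where `P` is a `C²` map whose values are invertible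
self-adjoint operators. The product `h` is linear in the first variable, while Mathlib's
`inner ℂ` is linear in the second. -/
structure HermitianMetricC2 (B : HolHilbertBundle E S) where
  /-- the hermitian product on the fibres -/
  h : ∀ s, B.Fib s → B.Fib s → ℂ
  local_form : ∀ i, ∃ P : S → (B.Model i →L[ℂ] B.Model i),
    ContMDiffOn 𝓘(ℝ, E) 𝓘(ℝ, B.Model i →L[ℂ] B.Model i) 2 P (B.dom i) ∧
    ∀ s : B.dom i, IsSelfAdjoint (P s) ∧ IsUnit (P s) ∧
      ∀ w₁ w₂, h s ((B.triv i s).symm w₁) ((B.triv i s).symm w₂) = inner ℂ w₂ (P s w₁)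
  pos : ∀ s (v : B.Fib s), v ≠ 0 → 0 < (h s v v).re

/-- `σ` is a holomorphic section of `B` over `U`. -/
def HolHilbertBundle.IsHolSection (B : HolHilbertBundle E S) (U : Opens S)
    (σ : ∀ s : U, B.Fib s) : Prop :=
  ∀ i, ∃ f : S → B.Model i, ContMDiffOn 𝓘(ℂ, E) 𝓘(ℂ, B.Model i) ω f (U ∩ B.dom i) ∧
    ∀ (s : S) (hU : s ∈ U) (hi : s ∈ B.dom i), f s = B.triv i ⟨s, hi⟩ (σ ⟨s, hU⟩)

/-- `(F, p)` is (isomorphic to) the sheaf of holomorphic sections of the bundle `B`,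
with `p(φ) = h(φ, φ)^{1/2}`. -/
def IsSheafOfSections {F : HolSheafMod E S} (p : SheafMetric F) (B : HolHilbertBundle E S)
    (H : HermitianMetricC2 B) : Prop :=
  ∃ e : ∀ U : Opens S, Sec F.val U → ∀ s : U, B.Fib s,
    (∀ U, Function.Injective (e U)) ∧
    (∀ U, Set.range (e U) = {σ | B.IsHolSection U σ}) ∧
    (∀ U (φ ψ : Sec F.val U) (s : U), e U (φ + ψ) s = e U φ s + e U ψ s) ∧
    (∀ U (f : HolRing E S U) (φ : Sec F.val U) (s : U), e U (f • φ) s = f.toMap s • e U φ s) ∧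
    (∀ (U V : Opens S) (hV : V ≤ U) (φ : Sec F.val U) (s : V),
      e V (Sec.res hV φ) s = e U φ ⟨s, hV s.2⟩) ∧
    (∀ U (φ : Sec F.val U) (s : U), (p.fn φ s : ℝ) = √(H.h s (e U φ s) (e U φ s)).re)

end Bundle

end

noncomputable section

/-! ## Circle averages and the sub-mean value property -/

section CircleAverages

/-! Since the curvature is an infimum over representatives and discs, it suffices to show `Λ(log‖α‖
∘ f)(0) ≥ 0` for each germ `α` with `‖α‖(s) ≠ 0` and each disc `f` through `s`. In a chart and a
trivialization `p(φ)² = ⟨Tφ, φ⟩`, with `T` of class C² and operator valued. With `x` the image of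
`s` and `A = T⁻¹∂T` at `x`, the sections `φ_v = (1 - A(· - x))v` see a metric without linear term at
`x`, whose quadratic part averages over `|z| = r` to `r²` times a Levi form. Let `m` be the supremum
over `v` of the ratio of this form to `T(x)`, in the direction of the disc.

Upper bound: the mean of `log p(φ_v)` over `|z| = r` is at most its central value plus `r²(m +
ε)/2`, for all small `r`, uniformly in `v` (`eventually_circleAverage_log_le`).

Lower bound: some `v₁` has ratio above `m - ε` at `x`, and by continuity (`continuousAt_leviOp`) at
least `m - ε` along the disc near `0`. By `le_lambdaOp_log_opForm`, `K(v₁) ≤ -(m - ε)` at the points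
`f(z)` in the direction `f'(z)`. The hypothesis gives the same bound for `K'`, so `Λ log p'(αφ_v) ≥
(m - ε)/2` wherever `αφ_v` is nonzero, near `0` and uniformly in `v`. A sub-mean value inequality
(`log_le_circleAverage`) and `p'(αφ_v) ≤ ‖α‖ p(φ_v)` bound `log p'(αφ_v)(s)` by the mean of `log‖α‖
+ log p(φ_v)` minus `r²(m - ε)/2`.

Now take `v` with `p'(αφ_v)(s) ≥ e^{-η} ‖α‖(s) p(φ_v)(s)`. The two bounds combine to `log‖α‖(s) - η
≤ mean of log‖α‖ + r²ε`. In infinite dimension the norm need not be attained, so `v` depends on `η`;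
but the admissible radii do not, and `η → 0` at fixed `r` (`zero_le_lambdaOp_of_family`). -/

theorem circleAverage_re_eq {F : ℂ → ℂ} {c : ℂ} {r : ℝ} (hF : DiffContOnCl ℂ F (Metric.ball c |r|)) :
    Real.circleAverage (fun z => (F z).re) c r = (F c).re := by
  have hint : CircleIntegrable F c r := by
    rcases eq_or_ne r 0 with rfl | hr
    · simp
    · refine (ContinuousOn.mono hF.2 ?_).circleIntegrable'
      rw [closure_ball _ (by simpa using hr)]
      exact Metric.sphere_subset_closedBall
  have := Complex.reCLM.circleAverage_comp_comm hint
  rw [hF.circleAverage] at this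
  exact this

/-- Trigonometric polynomials are uniformly dense on the circle, and `Re (p + conj q) = Re (p + q)`
makes their real parts real parts of holomorphic polynomials. This replaces solving the Dirichlet
problem: it yields a harmonic function with almost prescribed boundary values. -/
theorem exists_polynomial_re_sub_lt {g : ℂ → ℝ} {r : ℝ} (hr : 0 < r)
    (hg : ContinuousOn g (Metric.sphere 0 r)) {δ : ℝ} (hδ : 0 < δ) :
    ∃ q : Polynomial ℂ, ∀ z ∈ Metric.sphere (0 : ℂ) r, |(q.eval z).re - g z| < δ := by
  have : Fact (0 < 2 * Real.pi) := ⟨Real.two_pi_pos⟩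
  let G : C(AddCircle (2 * Real.pi), ℂ) :=
    ⟨fun t => (g (r * AddCircle.toCircle t) : ℂ), by
      refine Complex.continuous_ofReal.comp (hg.comp_continuous ?_ ?_)
      · exact continuous_const.mul (continuous_subtype_val.comp AddCircle.continuous_toCircle)
      · intro t
        rw [mem_sphere_zero_iff_norm, norm_mul, Circle.norm_coe, mul_one, Complex.norm_real,
          Real.norm_of_nonneg hr.le]⟩
  have hG : G ∈ closure (Submodule.span ℂ (Set.range (@fourier (2 * Real.pi))) : Set _) := by
    rw [← Submodule.topologicalClosure_coe, span_fourier_closure_eq_top]; trivial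
  obtain ⟨f, hf, hfG⟩ := Metric.mem_closure_iff.1 hG δ hδ
  have key : ∃ p q : Polynomial ℂ, ∀ t, f t = p.eval (AddCircle.toCircle t : ℂ)
      + (starRingEnd ℂ) (q.eval (AddCircle.toCircle t : ℂ)) := by
    clear hfG
    induction hf using Submodule.span_induction with
    | mem x h =>
      obtain ⟨n, rfl⟩ := h
      rcases Int.eq_nat_or_neg n with ⟨k, rfl | rfl⟩
      · refine ⟨Polynomial.X ^ k, 0, fun t => ?_⟩
        simp [fourier_apply, AddCircle.toCircle_nsmul]
      · refine ⟨0, Polynomial.X ^ k, fun t => ?_⟩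
        rw [fourier_neg]; simp [fourier_apply, AddCircle.toCircle_nsmul]
    | zero => exact ⟨0, 0, by simp⟩
    | add x y _ _ hx hy =>
      obtain ⟨p, q, h⟩ := hx
      obtain ⟨p', q', h'⟩ := hy
      refine ⟨p + p', q + q', fun t => ?_⟩
      simp [h, h']; ring
    | smul a x _ hx =>
      obtain ⟨p, q, h⟩ := hx
      refine ⟨Polynomial.C a * p, Polynomial.C ((starRingEnd ℂ) a) * q, fun t => ?_⟩
      simp [h]; ring
  obtain ⟨p, q, hpq⟩ := key
  refine ⟨(p + q).comp (Polynomial.C (r : ℂ)⁻¹ * Polynomial.X), fun z hz => ?_⟩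
  have hz' : ‖z‖ = r := by simpa using hz
  have hrC : (r : ℂ) ≠ 0 := by exact_mod_cast hr.ne'
  obtain ⟨t, ht⟩ := (AddCircle.homeomorphCircle (T := 2 * Real.pi) Real.two_pi_pos.ne').surjective
    (⟨(r : ℂ)⁻¹ * z, by
      simp [Submonoid.unitSphere, hz', abs_of_pos hr, hr.ne']⟩ : Circle)
  rw [AddCircle.homeomorphCircle_apply] at ht
  have ht' : (AddCircle.toCircle t : ℂ) = (r : ℂ)⁻¹ * z := by rw [ht]
  have h1 : dist (G t) (f t) < δ := (ContinuousMap.dist_apply_le_dist t).trans_lt hfG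
  rw [dist_comm, Complex.dist_eq] at h1
  have h2 := (Complex.abs_re_le_norm _).trans_lt h1
  have h3 : (r : ℂ) * ((r : ℂ)⁻¹ * z) = z := by field_simp
  simpa [G, hpq, ht', h3] using h2

theorem normSq_sub_eq (a z : ℂ) :
    ‖z‖ ^ 2 = (2 * (starRingEnd ℂ) a * (z - a)).re + ‖a‖ ^ 2 + ‖z - a‖ ^ 2 := by
  simp only [Complex.sq_norm, Complex.normSq_apply]
  simp
  ring

theorem ContinuousOn.circleIntegrable_of_closedBall {U : ℂ → ℝ} {c a : ℂ} {r ρ : ℝ}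
    (hU : ContinuousOn U (Metric.closedBall c r)) (h : Metric.closedBall a |ρ| ⊆ Metric.closedBall c r) :
    CircleIntegrable U a ρ :=
  (hU.mono (Metric.sphere_subset_closedBall.trans h)).circleIntegrable'

/-- On the circle of radius `ρ` about `a`, `‖z‖²` equals the real part of an affine function plus
constants, so the mean value property for holomorphic functions computes everything but the average
of `U`. -/
theorem circleAverage_add_norm_sq {U : ℂ → ℝ} {a : ℂ} {ρ δ : ℝ} {F : ℂ → ℂ}
    (hU : CircleIntegrable U a ρ) (hF : Differentiable ℂ F) :
    Real.circleAverage (fun z => U z + (F z).re + δ * ‖z‖ ^ 2) a ρ =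
      Real.circleAverage U a ρ + (F a).re + δ * ‖a‖ ^ 2 + δ * ρ ^ 2 := by
  let G : ℂ → ℂ := fun z => F z + δ * (2 * (starRingEnd ℂ) a * (z - a) + ‖a‖ ^ 2 + ρ ^ 2)
  have hG : Differentiable ℂ G := by fun_prop
  have h1 : Real.circleAverage (fun z => U z + (F z).re + δ * ‖z‖ ^ 2) a ρ =
      Real.circleAverage (fun z => U z + (G z).re) a ρ := by
    refine Real.circleAverage_congr_sphere fun z hz => ?_
    have hz' : ‖z - a‖ ^ 2 = ρ ^ 2 := by
      rw [mem_sphere_iff_norm.1 hz, sq_abs]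
    have := normSq_sub_eq a z
    rw [hz'] at this
    have h4 : (((‖a‖ : ℂ) ^ 2 : ℂ)).re = ‖a‖ ^ 2 := by norm_cast
    have h5 : (((ρ : ℂ) ^ 2 : ℂ)).re = ρ ^ 2 := by norm_cast
    simp only [G, this, Complex.add_re, Complex.re_ofReal_mul, h4, h5]
    ring
  rw [h1, Real.circleAverage_fun_add hU, circleAverage_re_eq hG.diffContOnCl]
  · have h4 : (((‖a‖ : ℂ) ^ 2 : ℂ)).re = ‖a‖ ^ 2 := by norm_cast
    have h5 : (((ρ : ℂ) ^ 2 : ℂ)).re = ρ ^ 2 := by norm_cast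
    simp only [G, Complex.add_re, Complex.re_ofReal_mul, h4, h5, sub_self, mul_zero, Complex.zero_re]
    ring
  · exact (Complex.continuous_re.comp hG.continuous).continuousOn.circleIntegrable'

/-- A maximum principle. At an interior maximum `a` of `U - Re q + δ‖z‖²` the averages of `U` over
small circles of radius `ρ` about `a` would lie at least `δρ²` below `U a`, so `Λ U(a) ≤ -δ`. Hence
the maximum lies on the sphere, where `Re q` almost equals `U`. -/
theorem le_circleAverage_of_lambdaOp_nonneg {U : ℂ → ℝ} {r : ℝ} (hr : 0 < r)
    (hU : ContinuousOn U (Metric.closedBall 0 r))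
    (h : ∀ z ∈ Metric.ball (0 : ℂ) r, 0 ≤ lambdaOp U z) :
    U 0 ≤ Real.circleAverage U 0 r := by
  have hUi : CircleIntegrable U 0 r :=
    hU.circleIntegrable_of_closedBall (by rw [abs_of_pos hr])
  -- One `δ` comes from comparing `U` with `Re q` at the boundary maximum, one from comparing their
  -- averages, and `δr²` from the term `δ‖z‖²` on the sphere.
  suffices H : ∀ δ > 0, U 0 ≤ Real.circleAverage U 0 r + δ * (2 + r ^ 2) by
    refine le_of_forall_pos_le_add fun ε hε => ?_
    have := H (ε / (2 + r ^ 2)) (by positivity)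
    rwa [div_mul_cancel₀ _ (by positivity)] at this
  intro δ hδ
  obtain ⟨q, hq⟩ := exists_polynomial_re_sub_lt hr
    (hU.mono Metric.sphere_subset_closedBall) hδ
  let V : ℂ → ℝ := fun z => U z + ((-q).eval z).re + δ * ‖z‖ ^ 2
  have hqd : Differentiable ℂ (fun z => (-q).eval z) := (-q).differentiable
  have hVc : ContinuousOn V (Metric.closedBall 0 r) := by
    refine (hU.add ?_).add (by fun_prop)
    exact (Complex.continuous_re.comp hqd.continuous).continuousOn
  obtain ⟨a, ha, hmax⟩ := (isCompact_closedBall (0 : ℂ) r).exists_isMaxOn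
    ⟨0, by simp [hr.le]⟩ hVc
  have hasph : a ∈ Metric.sphere (0 : ℂ) r := by
    by_contra hns
    have hab : a ∈ Metric.ball (0 : ℂ) r := by
      rw [← Metric.ball_union_sphere] at ha
      exact ha.resolve_right hns
    obtain ⟨ρ₀, hρ₀, hsub⟩ := Metric.isOpen_ball.mem_nhds hab |> Metric.nhds_basis_closedBall.mem_iff.1
    have hev : ∀ᶠ ρ : ℝ in 𝓝[>] 0,
        (((ρ ^ 2)⁻¹ * (Real.circleAverage U a ρ - U a) : ℝ) : EReal) ≤ ((-δ : ℝ) : EReal) := by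
      filter_upwards [Ioo_mem_nhdsGT hρ₀] with ρ hρ
      have hsub' : Metric.closedBall a |ρ| ⊆ Metric.closedBall 0 r := by
        rw [abs_of_pos hρ.1]
        exact ((Metric.closedBall_subset_closedBall hρ.2.le).trans hsub).trans
          Metric.ball_subset_closedBall
      have hi := hU.circleIntegrable_of_closedBall hsub'
      have h1 := circleAverage_add_norm_sq (δ := δ) hi hqd
      have h2 : Real.circleAverage V a ρ ≤ V a :=
        Real.circleAverage_mono_on_of_le_circle
          (hVc.circleIntegrable_of_closedBall hsub')
          fun z hz => hmax (hsub' (Metric.sphere_subset_closedBall hz))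
      rw [EReal.coe_le_coe_iff, inv_mul_le_iff₀ (by have := hρ.1; positivity)]
      change Real.circleAverage V a ρ = _ at h1
      rw [h1] at h2
      simp only [V] at h2
      linarith
    have h3 : lambdaOp U a ≤ ((-δ : ℝ) : EReal) :=
      limsup_le_of_le (by isBoundedDefault) hev
    have h4 := (h a hab).trans h3
    rw [← EReal.coe_zero, EReal.coe_le_coe_iff] at h4
    linarith
  have hV0 : V 0 ≤ V a := hmax (by simp [hr.le])
  have hq1 := abs_lt.1 (hq a hasph)
  have han : ‖a‖ = r := by simpa using hasph
  have hq0 : Real.circleAverage (fun z => (q.eval z).re) 0 r = (q.eval 0).re :=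
    circleAverage_re_eq q.differentiable.diffContOnCl
  have hq2 : Real.circleAverage (fun z => (q.eval z).re) 0 r ≤
      Real.circleAverage (fun z => U z + δ) 0 r := by
    refine Real.circleAverage_mono ?_ (hUi.add (circleIntegrable_const _ _ _)) fun z hz => ?_
    · exact (Complex.continuous_re.comp q.continuous).continuousOn.circleIntegrable'
    · rw [abs_of_pos hr] at hz
      have := abs_lt.1 (hq z hz)
      linarith
  rw [Real.circleAverage_fun_add hUi (circleIntegrable_const _ _ _),
    Real.circleAverage_const, hq0] at hq2
  simp only [V, Polynomial.eval_neg, Complex.neg_re, norm_zero, han] at hV0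
  nlinarith

end CircleAverages

/-! ## Hermitian forms of operators -/

section OpForm

variable {V : Type*} [NormedAddCommGroup V] [InnerProductSpace ℂ V]

/-- The quadratic form `re ⟨v, T v⟩`. -/
def opForm (T : V →L[ℂ] V) (v : V) : ℝ := (inner ℂ v (T v)).re

theorem opForm_add (T S : V →L[ℂ] V) (v : V) : opForm (T + S) v = opForm T v + opForm S v := by
  simp [opForm]

theorem opForm_sub (T S : V →L[ℂ] V) (v : V) : opForm (T - S) v = opForm T v - opForm S v := by
  simp [opForm]

theorem opForm_smul (c : ℝ) (T : V →L[ℂ] V) (v : V) : opForm (c • T) v = c * opForm T v := by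
  have : inner ℂ v ((c • T) v) = (c : ℂ) * inner ℂ v (T v) := by
    rw [← inner_smul_right]; rfl
  rw [opForm, this, Complex.re_ofReal_mul, opForm]

theorem abs_opForm_le (T : V →L[ℂ] V) (v : V) : |opForm T v| ≤ ‖T‖ * ‖v‖ ^ 2 := by
  calc |opForm T v| ≤ ‖inner ℂ v (T v)‖ := Complex.abs_re_le_norm _
    _ ≤ ‖v‖ * ‖T v‖ := norm_inner_le_norm _ _
    _ ≤ ‖v‖ * (‖T‖ * ‖v‖) := by gcongr; exact T.le_opNorm v
    _ = ‖T‖ * ‖v‖ ^ 2 := by ring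

@[simp] theorem opForm_zero (T : V →L[ℂ] V) : opForm T 0 = 0 := by simp [opForm]

theorem continuous_opForm : Continuous fun p : (V →L[ℂ] V) × V => opForm p.1 p.2 := by
  unfold opForm
  exact Complex.continuous_re.comp (continuous_snd.inner (continuous_fst.clm_apply continuous_snd))

/-- `T ↦ re ⟨v, T v⟩` as a real functional. -/
def opFormCLM (v : V) : (V →L[ℂ] V) →L[ℝ] ℝ :=
  LinearMap.mkContinuous ⟨⟨fun T => opForm T v, fun T S => opForm_add T S v⟩,
    fun c T => opForm_smul c T v⟩ (‖v‖ ^ 2) fun T => by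
      rw [mul_comm]; exact abs_opForm_le T v

@[simp] theorem opFormCLM_apply (v : V) (T : V →L[ℂ] V) : opFormCLM v T = opForm T v := rfl

variable [CompleteSpace V]

theorem opForm_conj (T S : V →L[ℂ] V) (v : V) : opForm (star S * T * S) v = opForm T (S v) := by
  simp only [opForm, mul_apply_eq_comp, ContinuousLinearMap.star_eq_adjoint,
    ContinuousLinearMap.adjoint_inner_right]

theorem inner_apply_eq_of_isSelfAdjoint {T : V →L[ℂ] V} (hT : IsSelfAdjoint T) (v w : V) :
    inner ℂ (T v) w = inner ℂ v (T w) := by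
  rw [← ContinuousLinearMap.adjoint_inner_right, ← ContinuousLinearMap.star_eq_adjoint, hT.star_eq]

/-- Cauchy–Schwarz for the semidefinite form of `T`: with `a = ⟨Tv, w⟩`, the form at `t a v + w` is
a nonnegative real quadratic in `t`. The factor `a` makes the cross term real, and the discriminant
gives the claim. -/
theorem norm_inner_sq_le_opForm_mul {T : V →L[ℂ] V} (hT : IsSelfAdjoint T)
    (hpos : ∀ v, 0 ≤ opForm T v) (v w : V) :
    ‖inner ℂ (T v) w‖ ^ 2 ≤ opForm T v * opForm T w := by
  have him : ∀ u : V, (inner ℂ u (T u)) = (opForm T u : ℂ) := by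
    intro u
    have h1 : (starRingEnd ℂ) (inner ℂ u (T u)) = inner ℂ u (T u) := by
      rw [inner_conj_symm, inner_apply_eq_of_isSelfAdjoint hT]
    exact (Complex.conj_eq_iff_re.1 h1).symm
  set a : ℂ := inner ℂ (T v) w with ha
  have key : ∀ t : ℝ, 0 ≤ (opForm T v * ‖a‖ ^ 2) * (t * t) + (2 * ‖a‖ ^ 2) * t + opForm T w := by
    intro t
    have h := hpos (((t : ℂ) * a) • v + w)
    have hwv : inner ℂ w (T v) = (starRingEnd ℂ) a := by rw [ha, inner_conj_symm]
    have hvw : inner ℂ v (T w) = a := by rw [ha, inner_apply_eq_of_isSelfAdjoint hT]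
    have e : opForm T (((t : ℂ) * a) • v + w) =
        (opForm T v * ‖a‖ ^ 2) * (t * t) + (2 * ‖a‖ ^ 2) * t + opForm T w := by
      rw [opForm]
      simp only [map_add, map_smul, inner_add_left, inner_add_right, inner_smul_left,
        inner_smul_right, him, hwv, hvw, Complex.sq_norm, Complex.normSq_apply]
      simp
      ring
    rwa [e] at h
  have hd := discrim_le_zero key
  rw [discrim] at hd
  rcases eq_or_ne a 0 with h0 | h0
  · rw [h0]; simpa using mul_nonneg (hpos v) (hpos w)
  · have : 0 < ‖a‖ ^ 2 := by positivity
    nlinarith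

/-- In infinite dimension positivity alone is not coercivity; invertibility supplies it.
Cauchy–Schwarz with `w = Tv` bounds `‖Tv‖²` by a multiple of the form at `v`, and `‖v‖ ≤ ‖T⁻¹‖
‖Tv‖`. -/
theorem exists_pos_mul_norm_sq_le_opForm {T : V →L[ℂ] V} (hT : IsSelfAdjoint T) (hu : IsUnit T)
    (hpos : ∀ v, v ≠ 0 → 0 < opForm T v) : ∃ c > 0, ∀ v, c * ‖v‖ ^ 2 ≤ opForm T v := by
  obtain ⟨u, rfl⟩ := hu
  set T : V →L[ℂ] V := (u : V →L[ℂ] V)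
  set S : V →L[ℂ] V := ↑u⁻¹ with hS
  have hp : ∀ v, 0 ≤ opForm T v := fun v => by
    rcases eq_or_ne v 0 with rfl | h
    · simp
    · exact (hpos v h).le
  -- The summands `1` keep the constant positive even when an operator norm is zero.
  refine ⟨(1 + ‖T‖)⁻¹ * ((1 + ‖S‖) ^ 2)⁻¹, by positivity, fun v => ?_⟩
  have h1 : S (T v) = v := by
    rw [← mul_apply_eq_comp, hS, Units.inv_mul]; rfl
  have h2 : ‖v‖ ≤ (1 + ‖S‖) * ‖T v‖ := by
    calc ‖v‖ = ‖S (T v)‖ := by rw [h1]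
      _ ≤ ‖S‖ * ‖T v‖ := S.le_opNorm _
      _ ≤ _ := by gcongr; linarith
  have h3 := norm_inner_sq_le_opForm_mul hT hp v (T v)
  have h4 : ‖inner ℂ (T v) (T v)‖ = ‖T v‖ ^ 2 := by
    rw [inner_self_eq_norm_sq_to_K]; simp
  rw [h4] at h3
  have h5 : opForm T (T v) ≤ (1 + ‖T‖) * ‖T v‖ ^ 2 :=
    (le_abs_self _).trans ((abs_opForm_le _ _).trans (by gcongr; linarith))
  have h6 : ‖T v‖ ^ 2 ≤ (1 + ‖T‖) * opForm T v := by
    rcases eq_or_ne (T v) 0 with h0 | h0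
    · have := hp v
      rw [h0, norm_zero, zero_pow two_ne_zero]
      positivity
    · have h7 : 0 < ‖T v‖ ^ 2 := by positivity
      have h8 : ‖T v‖ ^ 2 * ‖T v‖ ^ 2 ≤ ((1 + ‖T‖) * opForm T v) * ‖T v‖ ^ 2 := by
        have := mul_le_mul_of_nonneg_left h5 (hp v)
        nlinarith
      exact le_of_mul_le_mul_right h8 h7
  have h9 : ‖v‖ ^ 2 ≤ (1 + ‖S‖) ^ 2 * ((1 + ‖T‖) * opForm T v) := by
    calc ‖v‖ ^ 2 ≤ ((1 + ‖S‖) * ‖T v‖) ^ 2 := by gcongr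
      _ = (1 + ‖S‖) ^ 2 * ‖T v‖ ^ 2 := by ring
      _ ≤ _ := by gcongr
  rw [← mul_inv, mul_comm, ← div_eq_mul_inv, div_le_iff₀ (by positivity)]
  calc _ ≤ _ := h9
    _ = _ := by ring

end OpForm

/-! ## Second order expansions -/

section Jets

/-- By symmetry of the second derivative, the remainder has derivative `T'(x + l) - T'(x) - T''(x)l
= o(‖l‖)` at `l`. The mean value inequality on the ball of radius `‖k‖` then gains one more factor
`‖k‖`. -/
theorem ContDiffAt.sub_taylor_two_isLittleO {E F : Type*} [NormedAddCommGroup E] [NormedSpace ℝ E]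
    [NormedAddCommGroup F] [NormedSpace ℝ F] {T : E → F} {x : E} (hT : ContDiffAt ℝ 2 T x) :
    (fun k => T (x + k) - T x - fderiv ℝ T x k - (1 / 2 : ℝ) • fderiv ℝ (fderiv ℝ T) x k k)
      =o[𝓝 0] fun k => ‖k‖ ^ 2 := by
  set D2 := fderiv ℝ (fderiv ℝ T) x with hD2
  have hsymm : ∀ v w, D2 v w = D2 w v := hT.isSymmSndFDerivAt (by simp)
  have hd : HasFDerivAt (fderiv ℝ T) D2 x :=
    ((hT.fderiv_right (m := 1) (by norm_num)).differentiableAt (by norm_num)).hasFDerivAt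
  have hev : ∀ᶠ k in 𝓝 (0 : E), DifferentiableAt ℝ T (x + k) := by
    have h1 : ∀ᶠ y in 𝓝 x, DifferentiableAt ℝ T y :=
      (hT.eventually (by norm_num)).mono fun y hy => hy.differentiableAt (by norm_num)
    have h2 : Tendsto (fun k : E => x + k) (𝓝 0) (𝓝 x) := by
      have : Continuous fun k : E => x + k := by fun_prop
      simpa using this.tendsto 0
    exact h2.eventually h1
  rw [Asymptotics.isLittleO_iff]
  intro c hc
  have ho := (hasFDerivAt_iff_isLittleO_nhds_zero.1 hd)
  rw [Asymptotics.isLittleO_iff] at ho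
  obtain ⟨δ, hδ, hball⟩ := Metric.eventually_nhds_iff_ball.1 ((ho hc).and hev)
  filter_upwards [Metric.ball_mem_nhds (0 : E) hδ] with k hk
  let g : E → F := fun k => T (x + k) - T x - fderiv ℝ T x k - (1 / 2 : ℝ) • D2 k k
  have hg : ∀ l ∈ Metric.closedBall (0 : E) ‖k‖, HasFDerivWithinAt g
      (fderiv ℝ T (x + l) - fderiv ℝ T x - D2 l) (Metric.closedBall (0 : E) ‖k‖) l := by
    intro l hl
    have hl' : l ∈ Metric.ball (0 : E) δ :=
      Metric.closedBall_subset_ball (by simpa using hk) hl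
    have h1 : HasFDerivAt (fun k => T (x + k)) (fderiv ℝ T (x + l)) l :=
      (hasFDerivAt_comp_add_left x).2 (hball l hl').2.hasFDerivAt
    have h2 : HasFDerivAt (fun k => D2 k k) (D2 l + D2.flip l) l := by
      have := D2.hasFDerivAt (x := l) |>.clm_apply (hasFDerivAt_id l)
      refine this.congr_fderiv ?_
      ext w; simp
    have h3 := ((h1.sub_const (T x)).sub (fderiv ℝ T x).hasFDerivAt).sub (h2.const_smul (1 / 2 : ℝ))
    refine (h3.congr_fderiv ?_).hasFDerivWithinAt
    ext w
    simp only [sub_apply, smul_apply,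
      add_apply, ContinuousLinearMap.flip_apply, hsymm w l]
    rw [← two_smul ℝ (D2 l w), smul_smul]; norm_num
  have hb : ∀ l ∈ Metric.closedBall (0 : E) ‖k‖,
      ‖fderiv ℝ T (x + l) - fderiv ℝ T x - D2 l‖ ≤ c * ‖k‖ := by
    intro l hl
    have hl' : l ∈ Metric.ball (0 : E) δ :=
      Metric.closedBall_subset_ball (by simpa using hk) hl
    refine ((hball l hl').1).trans ?_
    have : ‖l‖ ≤ ‖k‖ := by simpa using hl
    gcongr
  have := (convex_closedBall (0 : E) ‖k‖).norm_image_sub_le_of_norm_hasFDerivWithin_le hg hb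
    (x := 0) (y := k) (by simp) (by simp)
  have hg0 : g 0 = 0 := by simp [g]
  rw [hg0, sub_zero, sub_zero] at this
  calc ‖g k‖ ≤ c * ‖k‖ * ‖k‖ := this
    _ = c * ‖‖k‖ ^ 2‖ := by rw [norm_pow, norm_norm]; ring

variable {E : Type*} [NormedAddCommGroup E] [NormedSpace ℂ E]

/-- The complex linear part of a real linear map between complex spaces. -/
def holPart {W : Type*} [NormedAddCommGroup W] [NormedSpace ℂ W] (D : E →L[ℝ] W) : E →L[ℂ] W where
  toFun k := (1 / 2 : ℂ) • (D k - Complex.I • D (Complex.I • k))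
  map_add' k l := by simp only [map_add, smul_add]; module
  map_smul' c k := by
    have h : ∀ y : E, D (c • y) = (c.re : ℂ) • D y + (c.im : ℂ) • D (Complex.I • y) := by
      intro y
      conv_lhs => rw [← Complex.re_add_im c, add_smul, mul_smul, map_add]
      congr 1
      · exact D.map_smul c.re y
      · exact D.map_smul c.im _
    have h2 : D (Complex.I • c • k) = (c.re : ℂ) • D (Complex.I • k) - (c.im : ℂ) • D k := by
      rw [smul_comm, h, smul_smul Complex.I, Complex.I_mul_I, neg_one_smul, map_neg]; module
    rw [h, h2, RingHom.id_apply]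
    conv_rhs => rw [← Complex.re_add_im c]
    match_scalars
    · ring
    · linear_combination (1 / 2 * (c.im : ℂ)) * Complex.I_sq
  cont := by fun_prop

end Jets

/-! ## The normalized second order jet of a hermitian metric -/

section MetricJet

variable {E : Type*} [NormedAddCommGroup E] [NormedSpace ℂ E]
  {V : Type*} [NormedAddCommGroup V] [InnerProductSpace ℂ V]

theorem holPart_apply {W : Type*} [NormedAddCommGroup W] [NormedSpace ℂ W] (D : E →L[ℝ] W) (k : E) :
    holPart D k = (1 / 2 : ℂ) • (D k - Complex.I • D (Complex.I • k)) := rfl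

/-- The connection form `T⁻¹ ∂T` of the metric `T` at `x`. -/
def connForm (T : E → V →L[ℂ] V) (x : E) : E →L[ℂ] V →L[ℂ] V :=
  (ContinuousLinearMap.mul ℂ (V →L[ℂ] V) (Ring.inverse (T x))).comp (holPart (fderiv ℝ T x))

theorem connForm_apply (T : E → V →L[ℂ] V) (x k : E) :
    connForm T x k = Ring.inverse (T x) * holPart (fderiv ℝ T x) k := rfl

variable [CompleteSpace V]

/-- The second order part of the metric `T` at `x` in the frame `1 - T⁻¹ ∂T`. -/
def metricJet (T : E → V →L[ℂ] V) (x : E) : E →L[ℝ] E →L[ℝ] V →L[ℂ] V :=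
  let M := ContinuousLinearMap.mul ℝ (V →L[ℂ] V)
  let A := (connForm T x).restrictScalars ℝ
  let A' := ((starL' ℝ : (V →L[ℂ] V) ≃L[ℝ] (V →L[ℂ] V)) : (V →L[ℂ] V) →L[ℝ] (V →L[ℂ] V)).comp A
  let D := fderiv ℝ T x
  (1 / 2 : ℝ) • fderiv ℝ (fderiv ℝ T) x - M.bilinearComp A' D - M.bilinearComp D A
    + M.bilinearComp A' ((M (T x)).comp A)

theorem metricJet_apply (T : E → V →L[ℂ] V) (x k l : E) :
    metricJet T x k l = (1 / 2 : ℝ) • fderiv ℝ (fderiv ℝ T) x k l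
      - star (connForm T x k) * fderiv ℝ T x l - fderiv ℝ T x k * connForm T x l
      + star (connForm T x k) * (T x * connForm T x l) := rfl

/-- The metric `T` near `x` in the frame `1 - T⁻¹ ∂T`. -/
def normalizedMetric (T : E → V →L[ℂ] V) (x k : E) : V →L[ℂ] V :=
  star (1 - connForm T x k) * T (x + k) * (1 - connForm T x k)

theorem isSelfAdjoint_fderiv {T : E → V →L[ℂ] V} {x : E} (hT : DifferentiableAt ℝ T x)
    (hsa : ∀ᶠ y in 𝓝 x, IsSelfAdjoint (T y)) (k : E) : IsSelfAdjoint (fderiv ℝ T x k) := by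
  have h1 : HasFDerivAt (fun y => star (T y))
      (((starL' ℝ : (V →L[ℂ] V) ≃L[ℝ] (V →L[ℂ] V)) : (V →L[ℂ] V) →L[ℝ] (V →L[ℂ] V)).comp
        (fderiv ℝ T x)) x :=
    ((starL' ℝ : (V →L[ℂ] V) ≃L[ℝ] (V →L[ℂ] V)) :
      (V →L[ℂ] V) →L[ℝ] (V →L[ℂ] V)).hasFDerivAt.comp x hT.hasFDerivAt
  have h2 : HasFDerivAt T _ x := h1.congr_of_eventuallyEq
    (hsa.mono fun y hy => (hy.star_eq).symm)
  have h3 := h2.unique hT.hasFDerivAt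
  have h4 := congrArg (fun L => L k) h3
  exact h4

/-- The frame `1 - A` is chosen to kill the linear term: self-adjointness gives `DT = ∂T + (∂T)*`,
and `T A = ∂T`, so `DT = A*T + TA`. `metricJet` collects the quadratic terms; what is left is at
least cubic or contains the Taylor remainder `R`. -/
theorem isLittleO_normalizedMetric {T : E → V →L[ℂ] V} {x : E} (hT : ContDiffAt ℝ 2 T x)
    (hsa : ∀ᶠ y in 𝓝 x, IsSelfAdjoint (T y)) (hu : IsUnit (T x)) :
    (fun k => normalizedMetric T x k - T x - metricJet T x k k) =o[𝓝 0] fun k => ‖k‖ ^ 2 := by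
  have hTx : IsSelfAdjoint (T x) := hsa.self_of_nhds
  have hDsa := isSelfAdjoint_fderiv (hT.differentiableAt (by norm_num)) hsa
  have hlin : ∀ k, fderiv ℝ T x k = star (connForm T x k) * T x + T x * connForm T x k := by
    intro k
    have h1 : T x * connForm T x k = holPart (fderiv ℝ T x) k := by
      rw [connForm_apply, ← mul_assoc, Ring.mul_inverse_cancel _ hu, one_mul]
    have h2 : star (connForm T x k) * T x = star (holPart (fderiv ℝ T x) k) := by
      rw [← h1, star_mul, hTx.star_eq]
    rw [h1, h2, holPart_apply, star_smul, star_sub, star_smul, (hDsa _).star_eq, (hDsa _).star_eq]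
    simp only [Complex.star_def, map_div₀, map_one, Complex.conj_I, map_ofNat]
    module
  set A := connForm T x with hA
  set D := fderiv ℝ T x with hD
  set D2 := fderiv ℝ (fderiv ℝ T) x with hD2
  let R : E → V →L[ℂ] V := fun k => T (x + k) - T x - D k - (1 / 2 : ℝ) • D2 k k
  have hR : R =o[𝓝 0] fun k => ‖k‖ ^ 2 := hT.sub_taylor_two_isLittleO
  have hAO : (fun k => A k) =O[𝓝 0] fun k => ‖k‖ := (A.isBigO_id _).norm_right
  have hAO' : (fun k => star (A k)) =O[𝓝 0] fun k => ‖k‖ := by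
    refine hAO.norm_left.congr_left (fun k => (norm_star (A k)).symm) |>.of_norm_left
  have hDO : (fun k => D k) =O[𝓝 0] fun k => ‖k‖ := (D.isBigO_id _).norm_right
  have hHO : (fun k => (1 / 2 : ℝ) • D2 k k) =O[𝓝 0] fun k => ‖k‖ ^ 2 := by
    refine Asymptotics.IsBigO.of_bound (1 / 2 * ‖D2‖) (Eventually.of_forall fun k => ?_)
    rw [norm_smul, norm_pow, norm_norm, pow_two, mul_assoc, ← mul_assoc ‖D2‖]
    refine mul_le_mul (by norm_num) (D2.le_opNorm₂ k k) (norm_nonneg _) (by norm_num)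
  have h3 : (fun k : E => ‖k‖ ^ 3) =o[𝓝 0] fun k => ‖k‖ ^ 2 :=
    (Asymptotics.isLittleO_pow_pow (by norm_num : 2 < 3)).comp_tendsto tendsto_norm_zero
  have h1 : (fun k : E => ‖k‖) =O[𝓝 0] fun _ => (1 : ℝ) :=
    (tendsto_norm_zero (E := E)).isBigO_one ℝ
  have hSO : (fun k => 1 - A k) =O[𝓝 0] fun _ => (1 : ℝ) :=
    (Asymptotics.isBigO_const_const _ one_ne_zero _).sub (hAO.trans h1)
  have hSO' : (fun k => star (1 - A k)) =O[𝓝 0] fun _ => (1 : ℝ) := by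
    refine hSO.norm_left.congr_left (fun k => (norm_star (1 - A k)).symm) |>.of_norm_left
  have e : ∀ k, normalizedMetric T x k - T x - metricJet T x k k =
      star (A k) * D k * A k - star (A k) * ((1 / 2 : ℝ) • D2 k k)
        - ((1 / 2 : ℝ) • D2 k k) * A k + star (A k) * ((1 / 2 : ℝ) • D2 k k) * A k
        + star (1 - A k) * R k * (1 - A k) := by
    intro k
    have hTk : T (x + k) = T x + D k + (1 / 2 : ℝ) • D2 k k + R k := by simp only [R]; abel
    rw [normalizedMetric, metricJet_apply, hTk, ← hA, ← hD, ← hD2]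
    have hk := hlin k
    set a := A k
    set d := D k
    set h := (1 / 2 : ℝ) • D2 k k
    have hk' : d - star a * T x - T x * a = 0 := by rw [hk]; abel
    calc _ = (d - star a * T x - T x * a) + (star a * d * a - star a * h - h * a + star a * h * a
        + star (1 - a) * R k * (1 - a)) := by rw [star_sub, star_one]; noncomm_ring
      _ = _ := by rw [hk', zero_add]
  refine Asymptotics.IsLittleO.congr_left ?_ fun k => (e k).symm
  refine Asymptotics.IsLittleO.add (Asymptotics.IsLittleO.add (Asymptotics.IsLittleO.sub
    (Asymptotics.IsLittleO.sub ?_ ?_) ?_) ?_) ?_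
  · exact (((hAO'.mul hDO).mul hAO).congr_right fun k => by ring).trans_isLittleO h3
  · exact ((hAO'.mul hHO).congr_right fun k => by ring).trans_isLittleO h3
  · exact ((hHO.mul hAO).congr_right fun k => by ring).trans_isLittleO h3
  · have := ((hAO'.mul hHO).mul (hAO.trans h1))
    exact (this.congr_right fun k => by ring).trans_isLittleO h3
  · exact ((hSO'.mul_isLittleO hR).mul_isBigO hSO).congr_right fun k => by ring

/-- The Levi form of the metric `T` at `x`, in the frame where its connection form vanishes. -/
def leviOp (T : E → V →L[ℂ] V) (x ξ : E) : V →L[ℂ] V :=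
  (1 / 2 : ℝ) • (metricJet T x ξ ξ + metricJet T x (Complex.I • ξ) (Complex.I • ξ))

/-- The Levi form uses only the second order jet of `T`, which is continuous for a C² metric. This
lets a vector that nearly maximizes the Levi ratio at the centre serve at all nearby points of the
disc. -/
theorem continuousAt_leviOp {T : E → V →L[ℂ] V} {X : Type*} [TopologicalSpace X] {x ξ : X → E}
    {t : X} (hT : ContDiffAt ℝ 2 T (x t)) (hu : IsUnit (T (x t))) (hx : ContinuousAt x t)
    (hξ : ContinuousAt ξ t) : ContinuousAt (fun y => leviOp T (x y) (ξ y)) t := by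
  have c0 : ContinuousAt (fun y => T (x y)) t := hT.continuousAt.comp hx
  have hT1 : ContDiffAt ℝ 1 (fderiv ℝ T) (x t) := hT.fderiv_right (by norm_num)
  have c1 : ContinuousAt (fun y => fderiv ℝ T (x y)) t := hT1.continuousAt.comp hx
  have c2 : ContinuousAt (fun y => fderiv ℝ (fderiv ℝ T) (x y)) t :=
    (hT1.fderiv_right (m := 0) (by norm_num)).continuousAt.comp hx
  have ci : ContinuousAt (fun y => Ring.inverse (T (x y))) t := by
    obtain ⟨u, hu⟩ := hu
    have := NormedRing.inverse_continuousAt u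
    rw [hu] at this
    exact ContinuousAt.comp (f := fun y => T (x y)) this c0
  have key : ∀ η : X → E, ContinuousAt η t →
      ContinuousAt (fun y => metricJet T (x y) (η y) (η y)) t := by
    intro η hη
    have ca : ContinuousAt (fun y => connForm T (x y) (η y)) t := by
      simp only [connForm_apply, holPart_apply]
      exact ci.mul (((c1.clm_apply hη).sub
        ((c1.clm_apply (hη.const_smul Complex.I)).const_smul Complex.I)).const_smul (1 / 2 : ℂ))
    simp only [metricJet_apply]
    exact (((((c2.clm_apply hη).clm_apply hη).const_smul (1 / 2 : ℝ)).sub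
      (ca.star.mul (c1.clm_apply hη))).sub ((c1.clm_apply hη).mul ca)).add
      (ca.star.mul (c0.mul ca))
  exact ((key ξ hξ).add (key _ (hξ.const_smul Complex.I))).const_smul (1 / 2 : ℝ)

/-- Without a linear term, replacing `G z - x` by `z • ξ` costs only `o(‖z‖²)`. Thus the second
derivative of the disc never enters, only its tangent vector. -/
theorem isLittleO_normalizedMetric_comp {T : E → V →L[ℂ] V} {x : E} (hT : ContDiffAt ℝ 2 T x)
    (hsa : ∀ᶠ y in 𝓝 x, IsSelfAdjoint (T y)) (hu : IsUnit (T x)) {G : ℂ → E} {ξ : E}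
    (hG : HasDerivAt G ξ 0) (hGx : G 0 = x) :
    (fun z => normalizedMetric T x (G z - x) - T x - metricJet T x (z • ξ) (z • ξ))
      =o[𝓝 0] fun z : ℂ => ‖z‖ ^ 2 := by
  have hlo : (fun z : ℂ => G z - x - z • ξ) =o[𝓝 0] fun z => ‖z‖ := by
    have := hasDerivAt_iff_isLittleO_nhds_zero.1 hG
    simp only [zero_add, hGx] at this
    exact this.norm_right
  have hlin : (fun z : ℂ => z • ξ) =O[𝓝 0] fun z => ‖z‖ := by
    refine Asymptotics.IsBigO.of_bound ‖ξ‖ (Eventually.of_forall fun z => ?_)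
    rw [norm_smul, norm_norm, mul_comm]
  have hO : (fun z : ℂ => G z - x) =O[𝓝 0] fun z => ‖z‖ := by
    simpa using hlo.isBigO.add hlin
  have htend : Tendsto (fun z : ℂ => G z - x) (𝓝 0) (𝓝 0) := by
    have := hG.continuousAt.tendsto.sub_const x
    rwa [hGx, sub_self] at this
  have h1 := (isLittleO_normalizedMetric hT hsa hu).comp_tendsto htend
  have h1' := h1.trans_isBigO (hO.norm_left.pow 2)
  set B := metricJet T x
  have hB : ∀ {f g : ℂ → E} , (fun z => B (f z) (g z)) =O[𝓝 0] fun z => ‖f z‖ * ‖g z‖ := by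
    intro f g
    refine Asymptotics.IsBigO.of_bound ‖B‖ (Eventually.of_forall fun z => ?_)
    rw [norm_mul, norm_norm, norm_norm, ← mul_assoc]
    exact B.le_opNorm₂ _ _
  have h2 : (fun z : ℂ => B (G z - x - z • ξ) (G z - x)) =o[𝓝 0] fun z : ℂ => ‖z‖ ^ 2 :=
    (hB.trans_isLittleO (hlo.norm_left.mul_isBigO hO.norm_left)).congr_right fun z => by ring
  have h3 : (fun z : ℂ => B (z • ξ) (G z - x - z • ξ)) =o[𝓝 0] fun z : ℂ => ‖z‖ ^ 2 :=
    (hB.trans_isLittleO (hlin.norm_left.mul_isLittleO hlo.norm_left)).congr_right fun z => by ring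
  refine ((h1'.add h2).add h3).congr_left fun z => ?_
  simp only [Function.comp_apply, map_sub, sub_apply]
  abel

end MetricJet

/-! ## Circle averages of the logarithm of a hermitian metric -/

section LogAverages

theorem circleAverage_comp_I_mul (f : ℂ → ℝ) (r : ℝ) :
    Real.circleAverage (fun z => f (Complex.I * z)) 0 r = Real.circleAverage f 0 r := by
  rw [Real.circleAverage_eq_integral_add (f := f) (Real.pi / 2), Real.circleAverage_def]
  have : ∀ θ : ℝ, Complex.I * circleMap 0 r θ = circleMap 0 r (θ + Real.pi / 2) := by
    intro θ
    simp only [circleMap, zero_add, Complex.ofReal_add, add_mul, Complex.exp_add]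
    rw [Complex.ofReal_div, Complex.ofReal_ofNat, Complex.exp_pi_div_two_mul_I]; ring
  simp only [this]

/-- Rotation by `i` preserves the average, while `b(zξ, zξ) + b(izξ, izξ)` is constant on the
circle: it is `r²` times the trace of `b` over the pair `ξ, iξ`, expressed in a rotated pair. -/
theorem circleAverage_bilin {E : Type*} [NormedAddCommGroup E] [NormedSpace ℂ E]
    (b : E →L[ℝ] E →L[ℝ] ℝ) (ξ : E) (r : ℝ) :
    Real.circleAverage (fun z : ℂ => b (z • ξ) (z • ξ)) 0 r =
      r ^ 2 * ((1 / 2 : ℝ) * (b ξ ξ + b (Complex.I • ξ) (Complex.I • ξ))) := by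
  have hc : Continuous fun z : ℂ => b (z • ξ) (z • ξ) := by fun_prop
  have hc' : Continuous fun z : ℂ => b ((Complex.I * z) • ξ) ((Complex.I * z) • ξ) := by fun_prop
  have h1 := circleAverage_comp_I_mul (fun z => b (z • ξ) (z • ξ)) r
  have h2 := Real.circleAverage_fun_add (hc.continuousOn.circleIntegrable' (c := 0) (R := r))
    (hc'.continuousOn.circleIntegrable')
  have h3 : Real.circleAverage (fun z : ℂ => b (z • ξ) (z • ξ)
      + b ((Complex.I * z) • ξ) ((Complex.I * z) • ξ)) 0 r =
      r ^ 2 * (b ξ ξ + b (Complex.I • ξ) (Complex.I • ξ)) := by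
    refine Real.circleAverage_const_on_circle fun z hz => ?_
    have hz' : z.re ^ 2 + z.im ^ 2 = r ^ 2 := by
      have : ‖z‖ = |r| := by simpa using hz
      rw [← sq_abs r, ← this, Complex.sq_norm, Complex.normSq_apply]; ring
    have e1 : z • ξ = z.re • ξ + z.im • (Complex.I • ξ) := by
      conv_lhs => rw [← Complex.re_add_im z, add_smul, mul_smul]
      rfl
    have e2 : (Complex.I * z) • ξ = z.re • (Complex.I • ξ) - z.im • ξ := by
      have : Complex.I * z = (z.re : ℂ) * Complex.I - (z.im : ℂ) := by
        conv_lhs => rw [← Complex.re_add_im z]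
        linear_combination (z.im : ℂ) * Complex.I_sq
      rw [this, sub_smul, mul_smul]
      rfl
    rw [e1, e2]
    simp only [map_add, map_sub, map_smul, add_apply, sub_apply, smul_apply, smul_eq_mul]
    rw [← hz']
    ring
  rw [h3, h1] at h2
  linarith

variable {E : Type*} [NormedAddCommGroup E] [NormedSpace ℂ E]
  {V : Type*} [NormedAddCommGroup V] [InnerProductSpace ℂ V] [CompleteSpace V]

theorem circleAverage_opForm_metricJet (T : E → V →L[ℂ] V) (x ξ : E) (v : V) (r : ℝ) :
    Real.circleAverage (fun z : ℂ => opForm (metricJet T x (z • ξ) (z • ξ)) v) 0 r =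
      r ^ 2 * opForm (leviOp T x ξ) v := by
  have h := circleAverage_bilin
    ((ContinuousLinearMap.compL ℝ E (V →L[ℂ] V) ℝ (opFormCLM v)).comp (metricJet T x)) ξ r
  simp only [ContinuousLinearMap.comp_apply, ContinuousLinearMap.compL_apply,
    opFormCLM_apply] at h
  rw [h, leviOp, opForm_smul, opForm_add]

/-- Uniformly in `v`, the mean values of `log p` of the section `(1 - T⁻¹ ∂T) v` along a disc
are bounded from above by the Levi form. -/
theorem eventually_circleAverage_log_le {T : E → V →L[ℂ] V} {x : E} (hT : ContDiffAt ℝ 2 T x)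
    (hsa : ∀ᶠ y in 𝓝 x, IsSelfAdjoint (T y)) (hu : IsUnit (T x))
    (hpos : ∀ v, v ≠ 0 → 0 < opForm (T x) v) {G : ℂ → E} {ξ : E}
    (hG : HasDerivAt G ξ 0) (hGc : ∀ᶠ z in 𝓝 0, ContinuousAt G z) (hGx : G 0 = x)
    {m : ℝ} (hm : ∀ v, opForm (leviOp T x ξ) v ≤ m * opForm (T x) v) {ε : ℝ} (hε : 0 < ε) :
    ∃ δ > 0, ∀ v, v ≠ 0 →
      (∀ z ∈ Metric.ball (0 : ℂ) δ, 0 < opForm (T (G z)) (v - connForm T x (G z - x) v)) ∧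
      ∀ r ∈ Set.Ioo 0 δ, Real.circleAverage (fun z => (1 / 2 : ℝ) *
        Real.log (opForm (T (G z)) (v - connForm T x (G z - x) v))) 0 r ≤
        (1 / 2 : ℝ) * Real.log (opForm (T x) v) + r ^ 2 * ((1 / 2 : ℝ) * (m + ε)) := by
  obtain ⟨c, hc, hcoer⟩ := exists_pos_mul_norm_sq_le_opForm hsa.self_of_nhds hu hpos
  have hexp := isLittleO_normalizedMetric_comp hT hsa hu hG hGx
  rw [Asymptotics.isLittleO_iff] at hexp
  set N := metricJet T x with hN
  have hNb : ∃ K > 0, ∀ z : ℂ, ‖N (z • ξ) (z • ξ)‖ ≤ K * ‖z‖ ^ 2 := by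
    refine ⟨‖N‖ * ‖ξ‖ ^ 2 + 1, by positivity, fun z => ?_⟩
    refine (N.le_opNorm₂ _ _).trans ?_
    rw [norm_smul]
    nlinarith [sq_nonneg ‖z‖]
  obtain ⟨K, hK, hNK⟩ := hNb
  have hTG : ∀ᶠ z in 𝓝 (0 : ℂ), ContinuousAt (fun z => T (G z)) z := by
    have h1 : ∀ᶠ y in 𝓝 x, ContinuousAt T y :=
      (hT.eventually (by norm_num)).mono fun y hy => hy.continuousAt
    have h2 : Tendsto G (𝓝 0) (𝓝 x) := by simpa [hGx] using hG.continuousAt.tendsto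
    filter_upwards [h2.eventually h1, hGc] with z hz hz'
    exact hz.comp hz'
  have hsmall : ∀ᶠ z in 𝓝 (0 : ℂ), (K + ε * c) * ‖z‖ ^ 2 < c := by
    have : Tendsto (fun z : ℂ => (K + ε * c) * ‖z‖ ^ 2) (𝓝 0) (𝓝 ((K + ε * c) * ‖(0 : ℂ)‖ ^ 2)) :=
      Continuous.tendsto (by fun_prop) _
    rw [norm_zero, zero_pow two_ne_zero, mul_zero] at this
    exact this.eventually (gt_mem_nhds hc)
  obtain ⟨δ, hδ, hball⟩ := Metric.eventually_nhds_iff_ball.1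
    ((hexp (show 0 < ε * c by positivity)).and (hsmall.and (hTG.and hGc)))
  refine ⟨δ, hδ, fun v hv => ?_⟩
  have hv2 : 0 < ‖v‖ ^ 2 := by positivity
  set q₀ := opForm (T x) v with hq₀
  have hq₀pos : 0 < q₀ := hpos v hv
  set q : ℂ → ℝ := fun z => opForm (T (G z)) (v - connForm T x (G z - x) v) with hq
  have hqQ : ∀ z, q z = opForm (normalizedMetric T x (G z - x)) v := by
    intro z
    rw [normalizedMetric, opForm_conj, add_sub_cancel]
    rfl
  -- The operator error is `εc‖z‖²`; coercivity turns `c‖v‖²` into `q₀`. The error is therefore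
  -- relative to `q₀`, which makes `δ` independent of `v`.
  have hest : ∀ z ∈ Metric.ball (0 : ℂ) δ,
      |q z - q₀ - opForm (N (z • ξ) (z • ξ)) v| ≤ ε * ‖z‖ ^ 2 * q₀ := by
    intro z hz
    rw [hqQ, hq₀, ← opForm_sub, ← opForm_sub]
    have h1 := (hball z hz).1
    rw [norm_pow, norm_norm] at h1
    calc _ ≤ _ := abs_opForm_le _ _
      _ ≤ ε * c * ‖z‖ ^ 2 * ‖v‖ ^ 2 := by gcongr
      _ = ε * ‖z‖ ^ 2 * (c * ‖v‖ ^ 2) := by ring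
      _ ≤ _ := by gcongr; exact hcoer v
  have hqpos : ∀ z ∈ Metric.ball (0 : ℂ) δ, 0 < q z := by
    intro z hz
    have h1 := abs_le.1 (hest z hz)
    have h2 := abs_le.1 ((abs_opForm_le (N (z • ξ) (z • ξ)) v).trans
      (mul_le_mul_of_nonneg_right (hNK z) hv2.le))
    have h3 := (hball z hz).2.1
    have h4 := hcoer v
    have h5 : K * ‖z‖ ^ 2 * ‖v‖ ^ 2 ≤ K * ‖z‖ ^ 2 / c * q₀ := by
      calc K * ‖z‖ ^ 2 * ‖v‖ ^ 2 = K * ‖z‖ ^ 2 / c * (c * ‖v‖ ^ 2) := by field_simp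
        _ ≤ _ := by gcongr
    have h6 : (K * ‖z‖ ^ 2 / c + ε * ‖z‖ ^ 2) * q₀ < 1 * q₀ := by
      gcongr
      have : K * ‖z‖ ^ 2 / c + ε * ‖z‖ ^ 2 = ((K + ε * c) * ‖z‖ ^ 2) / c := by field_simp
      rw [this, div_lt_one hc]; exact h3
    linarith
  refine ⟨hqpos, fun r hr => ?_⟩
  have hsph : Metric.sphere (0 : ℂ) |r| ⊆ Metric.ball 0 δ := by
    rw [abs_of_pos hr.1]
    exact Metric.sphere_subset_ball hr.2
  have hqc : ContinuousOn q (Metric.ball 0 δ) := by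
    intro z hz
    refine ContinuousAt.continuousWithinAt ?_
    have h1 := (hball z hz).2.2.1
    have h2 := (hball z hz).2.2.2
    have h3 : ContinuousAt (fun z => v - connForm T x (G z - x) v) z :=
      continuousAt_const.sub (((connForm T x).continuous.continuousAt.comp
        (h2.sub continuousAt_const)).clm_apply continuousAt_const)
    exact ContinuousAt.comp (f := fun z => (T (G z), v - connForm T x (G z - x) v))
      continuous_opForm.continuousAt (h1.prodMk h3)
  have hlogint : CircleIntegrable (fun z => (1 / 2 : ℝ) * Real.log (q z)) 0 r := by
    refine (ContinuousOn.mono ?_ hsph).circleIntegrable'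
    exact continuousOn_const.mul (hqc.log fun z hz => (hqpos z hz).ne')
  have hNc : Continuous fun z : ℂ => opForm (N (z • ξ) (z • ξ)) v := by
    have : Continuous fun z : ℂ => opFormCLM v (N (z • ξ) (z • ξ)) := by fun_prop
    exact this
  have hint2 : CircleIntegrable (fun z : ℂ => (1 / 2 : ℝ) * Real.log q₀ + r ^ 2 * ((1 / 2) * ε)
      + (2 * q₀)⁻¹ * opForm (N (z • ξ) (z • ξ)) v) 0 r :=
    Continuous.continuousOn (by fun_prop) |>.circleIntegrable'
  refine (Real.circleAverage_mono hlogint hint2 fun z hz => ?_).trans ?_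
  · have hzb := hsph hz
    have hzr : ‖z‖ = r := by
      rw [abs_of_pos hr.1] at hz; simpa using hz
    have h1 := (abs_le.1 (hest z hzb)).2
    rw [hzr] at h1
    -- For the upper bound `log t ≤ t - 1` at `t = q z / q₀` suffices, because the average of the
    -- quadratic term is known exactly.
    have h2 := Real.log_le_sub_one_of_pos (div_pos (hqpos z hzb) hq₀pos)
    rw [Real.log_div (hqpos z hzb).ne' hq₀pos.ne'] at h2
    have h3 : q z / q₀ - 1 ≤ q₀⁻¹ * opForm (N (z • ξ) (z • ξ)) v + ε * r ^ 2 := by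
      rw [div_sub_one hq₀pos.ne', div_le_iff₀ hq₀pos]
      have : (q₀⁻¹ * opForm (N (z • ξ) (z • ξ)) v + ε * r ^ 2) * q₀ =
          opForm (N (z • ξ) (z • ξ)) v + ε * r ^ 2 * q₀ := by field_simp
      linarith
    have h4 : (2 * q₀)⁻¹ = (1 / 2) * q₀⁻¹ := by rw [mul_inv]; norm_num
    rw [h4]
    linarith
  · have e : Real.circleAverage (fun z : ℂ => (1 / 2 : ℝ) * Real.log q₀ + r ^ 2 * ((1 / 2) * ε)
        + (2 * q₀)⁻¹ * opForm (N (z • ξ) (z • ξ)) v) 0 r =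
        (1 / 2 : ℝ) * Real.log q₀ + r ^ 2 * ((1 / 2) * ε)
        + (2 * q₀)⁻¹ * (r ^ 2 * opForm (leviOp T x ξ) v) := by
      rw [Real.circleAverage_fun_add (circleIntegrable_const _ _ _)
        (Continuous.continuousOn (by fun_prop)).circleIntegrable', Real.circleAverage_const,
        ← circleAverage_opForm_metricJet]
      congr 1
      exact Real.circleAverage_fun_smul (a := (2 * q₀)⁻¹)
    rw [e]
    have h5 : (2 * q₀)⁻¹ * (r ^ 2 * opForm (leviOp T x ξ) v) ≤ (2 * q₀)⁻¹ * (r ^ 2 * (m * q₀)) := by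
      gcongr; exact hm v
    have h6 : (2 * q₀)⁻¹ * (r ^ 2 * (m * q₀)) = r ^ 2 * ((1 / 2) * m) := by field_simp
    linarith

end LogAverages

/-! ## The Levi form of the logarithm of the norm of a holomorphic section -/

section LowerBound

variable {E : Type*} [NormedAddCommGroup E] [NormedSpace ℂ E]
  {V : Type*} [NormedAddCommGroup V] [InnerProductSpace ℂ V] [CompleteSpace V]

theorem abs_opForm_sub_opForm_le {V : Type*} [NormedAddCommGroup V] [InnerProductSpace ℂ V]
    (T : V →L[ℂ] V) (a b : V) :
    |opForm T a - opForm T b| ≤ ‖T‖ * (‖a - b‖ * (‖a‖ + ‖b‖)) := by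
  have e : opForm T a - opForm T b =
      (inner ℂ (a - b) (T a)).re + (inner ℂ b (T (a - b))).re := by
    simp only [opForm, inner_sub_left, map_sub, inner_sub_right, Complex.sub_re]; ring
  rw [e]
  calc _ ≤ |(inner ℂ (a - b) (T a)).re| + |(inner ℂ b (T (a - b))).re| := abs_add_le _ _
    _ ≤ ‖a - b‖ * ‖T a‖ + ‖b‖ * ‖T (a - b)‖ := by
      gcongr
      · exact (Complex.abs_re_le_norm _).trans (norm_inner_le_norm _ _)
      · exact (Complex.abs_re_le_norm _).trans (norm_inner_le_norm _ _)
    _ ≤ ‖a - b‖ * (‖T‖ * ‖a‖) + ‖b‖ * (‖T‖ * ‖a - b‖) := by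
      gcongr <;> exact T.le_opNorm _
    _ = _ := by ring

theorem le_lambdaOp_of_circleAverage {u : ℂ → ℝ} {a : ℂ} {m : ℝ}
    (h : ∀ ε > 0, ∀ᶠ r : ℝ in 𝓝[>] 0, u a + r ^ 2 * (m - ε) ≤ Real.circleAverage u a r) :
    (m : EReal) ≤ lambdaOp u a := by
  rw [← EReal.ge_of_forall_gt_iff_ge]
  intro z hz
  have hz' : 0 < m - z := sub_pos.2 (EReal.coe_lt_coe_iff.1 hz)
  refine le_limsup_of_frequently_le (Eventually.frequently ?_) (by isBoundedDefault)
  filter_upwards [h _ hz', self_mem_nhdsWithin] with r hr hr0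
  have hr0' : (0 : ℝ) < r := hr0
  rw [EReal.coe_le_coe_iff, le_inv_mul_iff₀ (by positivity)]
  rw [sub_sub_cancel] at hr
  linarith

/-- Write `Φ = SΨ` in the normalized frame, so that the squared norm is the `T(x)`-form of `Ψ` plus
the quadratic jet plus `o(‖z‖²)`. By Cauchy–Schwarz the first term is at least `|g|²/q₀` with `g =
⟨T(x)v, Ψ⟩` holomorphic, and `log|g|` is harmonic near `0`; so the derivatives of `Φ` cannot lower
the bound. It thus holds for every section with value `v`. -/
theorem le_lambdaOp_log_opForm {T : E → V →L[ℂ] V} {x : E} (hT : ContDiffAt ℝ 2 T x)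
    (hsa : ∀ᶠ y in 𝓝 x, IsSelfAdjoint (T y)) (hu : IsUnit (T x))
    (hpos : ∀ v, v ≠ 0 → 0 < opForm (T x) v) {G : ℂ → E} {ξ : E}
    (hG : HasDerivAt G ξ 0) (hGd : ∀ᶠ z in 𝓝 0, DifferentiableAt ℂ G z) (hGx : G 0 = x)
    {Φ : ℂ → V} (hΦ : ∀ᶠ z in 𝓝 0, DifferentiableAt ℂ Φ z) (hv : Φ 0 ≠ 0)
    {m : ℝ} (hm : m * opForm (T x) (Φ 0) ≤ opForm (leviOp T x ξ) (Φ 0)) :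
    (((1 / 2 : ℝ) * m : ℝ) : EReal) ≤
      lambdaOp (fun z => (1 / 2 : ℝ) * Real.log (opForm (T (G z)) (Φ z))) 0 := by
  set v := Φ 0 with hv_def
  set q₀ := opForm (T x) v with hq₀
  have hq₀pos : 0 < q₀ := hpos v hv
  have hpos' : ∀ w, 0 ≤ opForm (T x) w := fun w => by
    rcases eq_or_ne w 0 with rfl | h
    · simp
    · exact (hpos w h).le
  have hTx : IsSelfAdjoint (T x) := hsa.self_of_nhds
  set S : ℂ → V →L[ℂ] V := fun z => 1 - connForm T x (G z - x) with hS
  have hS0 : S 0 = 1 := by simp [hS, hGx]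
  have hSd : ∀ᶠ z in 𝓝 0, DifferentiableAt ℂ S z := by
    filter_upwards [hGd] with z hz
    exact (differentiableAt_const _).sub
      ((connForm T x).differentiableAt.comp z (hz.sub_const x))
  have hSu : ∀ᶠ z in 𝓝 0, IsUnit (S z) := by
    have h1 : {a : V →L[ℂ] V | IsUnit a} ∈ 𝓝 (S 0) :=
      Units.isOpen.mem_nhds (by rw [hS0]; exact isUnit_one)
    exact hSd.self_of_nhds.continuousAt.tendsto h1
  set Ψ : ℂ → V := fun z => Ring.inverse (S z) (Φ z) with hΨ
  have hΨ0 : Ψ 0 = v := by simp [hΨ, hS0, hv_def]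
  have hSΨ : ∀ᶠ z in 𝓝 0, S z (Ψ z) = Φ z := by
    filter_upwards [hSu] with z hz
    change (S z * Ring.inverse (S z)) (Φ z) = Φ z
    rw [Ring.mul_inverse_cancel _ hz]; rfl
  have hΨd : ∀ᶠ z in 𝓝 0, DifferentiableAt ℂ Ψ z := by
    filter_upwards [hSd, hSu, hΦ] with z h1 h2 h3
    exact (h1.inverse h2).clm_apply h3
  have hΨc : ContinuousAt Ψ 0 := hΨd.self_of_nhds.continuousAt
  have hexp := isLittleO_normalizedMetric_comp hT hsa hu hG hGx
  set N := metricJet T x with hN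
  set q : ℂ → ℝ := fun z => opForm (T (G z)) (Φ z) with hq
  have hq0 : q 0 = q₀ := by simp only [hq, hGx, ← hv_def, hq₀]
  set n : ℂ → ℝ := fun z => opForm (N (z • ξ) (z • ξ)) v with hn
  set R : ℂ → V →L[ℂ] V := fun z => normalizedMetric T x (G z - x) - T x - N (z • ξ) (z • ξ)
    with hR
  set e : ℂ → ℝ := fun z => opForm (R z) (Ψ z) +
    (opForm (N (z • ξ) (z • ξ)) (Ψ z) - opForm (N (z • ξ) (z • ξ)) v) with he
  have hNO : (fun z : ℂ => N (z • ξ) (z • ξ)) =O[𝓝 0] fun z : ℂ => ‖z‖ ^ 2 := by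
    refine Asymptotics.IsBigO.of_bound (‖N‖ * ‖ξ‖ ^ 2) (Eventually.of_forall fun z => ?_)
    refine (N.le_opNorm₂ _ _).trans (le_of_eq ?_)
    rw [norm_smul, norm_pow, norm_norm]; ring
  have hΨO : Ψ =O[𝓝 0] fun _ => (1 : ℝ) := hΨc.tendsto.isBigO_one ℝ
  have heo : e =o[𝓝 0] fun z : ℂ => ‖z‖ ^ 2 := by
    refine Asymptotics.IsLittleO.add ?_ ?_
    · have h1 : (fun z => ‖R z‖ * ‖Ψ z‖ ^ 2) =o[𝓝 0] fun z : ℂ => ‖z‖ ^ 2 :=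
        (hexp.norm_left.mul_isBigO (hΨO.norm_left.pow 2)).congr_right fun z => by ring
      refine (Asymptotics.IsBigO.of_bound 1 (Eventually.of_forall fun z => ?_)).trans_isLittleO h1
      rw [one_mul, Real.norm_eq_abs, Real.norm_of_nonneg (by positivity)]
      exact abs_opForm_le _ _
    · have h0 : (fun z => Ψ z - v) =o[𝓝 0] fun _ => (1 : ℝ) := by
        rw [Asymptotics.isLittleO_one_iff]
        have := hΨc.tendsto.sub_const v
        rwa [hΨ0, sub_self] at this
      have h2 : (fun z => ‖Ψ z‖ + ‖v‖) =O[𝓝 0] fun _ => (1 : ℝ) :=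
        hΨO.norm_left.add (Asymptotics.isBigO_const_const _ one_ne_zero _)
      have h1 : (fun z => ‖N (z • ξ) (z • ξ)‖ * (‖Ψ z - v‖ * (‖Ψ z‖ + ‖v‖)))
          =o[𝓝 0] fun z : ℂ => ‖z‖ ^ 2 :=
        (hNO.norm_left.mul_isLittleO (h0.norm_left.mul_isBigO h2)).congr_right fun z => by ring
      refine (Asymptotics.IsBigO.of_bound 1 (Eventually.of_forall fun z => ?_)).trans_isLittleO h1
      rw [one_mul, Real.norm_eq_abs, Real.norm_of_nonneg (by positivity)]
      exact abs_opForm_sub_opForm_le _ _ _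
  have hqe : ∀ᶠ z in 𝓝 0, q z = opForm (T x) (Ψ z) + n z + e z := by
    filter_upwards [hSΨ] with z hz
    have h1 : q z = opForm (normalizedMetric T x (G z - x)) (Ψ z) := by
      rw [normalizedMetric, opForm_conj, add_sub_cancel]
      change q z = opForm (T (G z)) (S z (Ψ z))
      rw [hz]
    have h2 : normalizedMetric T x (G z - x) = T x + N (z • ξ) (z • ξ) + R z := by
      simp only [hR]; abel
    rw [h1, h2, opForm_add, opForm_add]
    simp only [he, hn]; ring
  have hTG : ∀ᶠ z in 𝓝 (0 : ℂ), ContinuousAt (fun z => T (G z)) z := by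
    have h1 : ∀ᶠ y in 𝓝 x, ContinuousAt T y :=
      (hT.eventually (by norm_num)).mono fun y hy => hy.continuousAt
    have h2 : Tendsto G (𝓝 0) (𝓝 x) := by simpa [hGx] using hG.continuousAt.tendsto
    filter_upwards [h2.eventually h1, hGd] with z hz hz'
    exact hz.comp hz'.continuousAt
  have hqc : ∀ᶠ z in 𝓝 (0 : ℂ), ContinuousAt q z := by
    filter_upwards [hTG, hΦ] with z h1 h2
    exact ContinuousAt.comp (f := fun z => (T (G z), Φ z))
      continuous_opForm.continuousAt (h1.prodMk h2.continuousAt)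
  have hqtend : Tendsto q (𝓝 0) (𝓝 q₀) := by
    have := hqc.self_of_nhds.tendsto
    rwa [hq0] at this
  have hqpos : ∀ᶠ z in 𝓝 (0 : ℂ), 0 < q z := hqtend.eventually (lt_mem_nhds hq₀pos)
  -- The `T(x)`-component of `Ψ` along `v`, up to scale. Its value at `0` is the positive number
  -- `q₀`, so a branch of its logarithm exists nearby.
  set g : ℂ → ℂ := fun z => inner ℂ (T x v) (Ψ z) with hg
  have hg0 : g 0 = (q₀ : ℂ) := by
    have h1 : (starRingEnd ℂ) (inner ℂ v (T x v)) = inner ℂ v (T x v) := by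
      rw [inner_conj_symm, inner_apply_eq_of_isSelfAdjoint hTx]
    simp only [hg, hΨ0]
    rw [inner_apply_eq_of_isSelfAdjoint hTx]
    exact (Complex.conj_eq_iff_re.1 h1).symm
  have hgd : ∀ᶠ z in 𝓝 0, DifferentiableAt ℂ g z := by
    filter_upwards [hΨd] with z hz
    exact (innerSL ℂ (T x v)).differentiableAt.comp z hz
  have hgs : ∀ᶠ z in 𝓝 0, g z ∈ Complex.slitPlane := by
    refine hgd.self_of_nhds.continuousAt.tendsto (Complex.isOpen_slitPlane.mem_nhds ?_)
    rw [hg0]; exact Complex.ofReal_mem_slitPlane.2 hq₀pos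
  have hfo : (fun z => (n z + e z) / q z - n z / q₀) =o[𝓝 0] fun z : ℂ => ‖z‖ ^ 2 := by
    have hnO : n =O[𝓝 0] fun z : ℂ => ‖z‖ ^ 2 := by
      refine Asymptotics.IsBigO.trans
        (Asymptotics.IsBigO.of_bound (‖v‖ ^ 2) (Eventually.of_forall fun z => ?_)) hNO
      rw [mul_comm]; exact abs_opForm_le _ _
    have hinv : Tendsto (fun z => (q z)⁻¹) (𝓝 0) (𝓝 q₀⁻¹) := hqtend.inv₀ hq₀pos.ne'
    have h1 : (fun z => (q z)⁻¹ - q₀⁻¹) =o[𝓝 0] fun _ => (1 : ℝ) := by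
      rw [Asymptotics.isLittleO_one_iff]
      simpa using hinv.sub_const q₀⁻¹
    have h2 : (fun z => n z * ((q z)⁻¹ - q₀⁻¹)) =o[𝓝 0] fun z : ℂ => ‖z‖ ^ 2 :=
      (hnO.mul_isLittleO h1).congr_right fun z => by ring
    have h3 : (fun z => e z * (q z)⁻¹) =o[𝓝 0] fun z : ℂ => ‖z‖ ^ 2 :=
      (heo.mul_isBigO (hinv.isBigO_one ℝ)).congr_right fun z => by ring
    refine (h2.add h3).congr_left fun z => ?_
    rw [div_eq_mul_inv, div_eq_mul_inv]; ring
  refine le_lambdaOp_of_circleAverage fun ε hε => ?_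
  rw [Asymptotics.isLittleO_iff] at hfo
  obtain ⟨δ, hδ, hball⟩ := Metric.eventually_nhds_iff_ball.1
    ((hfo hε).and (hqe.and (hqc.and (hqpos.and (hgd.and hgs)))))
  filter_upwards [Ioo_mem_nhdsGT hδ] with r hr
  have hsph : Metric.sphere (0 : ℂ) |r| ⊆ Metric.ball 0 δ := by
    rw [abs_of_pos hr.1]
    exact Metric.sphere_subset_ball hr.2
  have hlogint : CircleIntegrable (fun z => (1 / 2 : ℝ) * Real.log (q z)) 0 r := by
    refine ContinuousOn.circleIntegrable' fun z hz => ?_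
    obtain ⟨_, _, h1, h2, _⟩ := hball z (hsph hz)
    exact (continuousAt_const.mul (h1.log h2.ne')).continuousWithinAt
  have hgdiff : DiffContOnCl ℂ (fun z => Complex.log (g z)) (Metric.ball 0 |r|) := by
    refine DifferentiableOn.diffContOnCl fun z hz => ?_
    have hz' : z ∈ Metric.ball (0 : ℂ) δ := by
      refine Metric.closedBall_subset_ball ?_ (Metric.closure_ball_subset_closedBall hz)
      rw [abs_of_pos hr.1]; exact hr.2
    obtain ⟨_, _, _, _, h1, h2⟩ := hball z hz'
    exact (h1.clog h2).differentiableWithinAt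
  have hgint : CircleIntegrable (fun z => (Complex.log (g z)).re) 0 r := by
    refine ContinuousOn.circleIntegrable' fun z hz => ?_
    obtain ⟨_, _, _, _, h1, h2⟩ := hball z (hsph hz)
    exact (Complex.continuous_re.continuousAt.comp (h1.clog h2).continuousAt).continuousWithinAt
  have hnc : Continuous n := by
    have : Continuous fun z : ℂ => opFormCLM v (N (z • ξ) (z • ξ)) := by fun_prop
    exact this
  have hnint : CircleIntegrable (fun z => (2 * q₀)⁻¹ * n z +
      (-(1 / 2 : ℝ) * Real.log q₀ - (1 / 2 : ℝ) * (ε * r ^ 2))) 0 r :=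
    Continuous.continuousOn (by fun_prop) |>.circleIntegrable'
  have hmono := Real.circleAverage_mono (hgint.add hnint) hlogint fun z hz => ?_
  · have hc1 : Real.circleAverage (fun z => (2 * q₀)⁻¹ * n z) 0 r =
        (2 * q₀)⁻¹ * (r ^ 2 * opForm (leviOp T x ξ) v) := by
      rw [← circleAverage_opForm_metricJet]
      exact Real.circleAverage_fun_smul (a := (2 * q₀)⁻¹)
    rw [Real.circleAverage_add hgint hnint, circleAverage_re_eq hgdiff,
      Real.circleAverage_fun_add (Continuous.continuousOn (by fun_prop)).circleIntegrable'
      (circleIntegrable_const _ _ _), Real.circleAverage_const, hc1, hg0, Complex.log_re,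
      Complex.norm_real, Real.norm_of_nonneg hq₀pos.le] at hmono
    have h5 : (2 * q₀)⁻¹ * (r ^ 2 * (m * q₀)) ≤ (2 * q₀)⁻¹ * (r ^ 2 * opForm (leviOp T x ξ) v) := by
      gcongr
    have h6 : (2 * q₀)⁻¹ * (r ^ 2 * (m * q₀)) = r ^ 2 * ((1 / 2) * m) := by field_simp
    have h7 : 0 < ε * r ^ 2 := by have := hr.1; positivity
    rw [h6] at h5
    change (1 / 2 : ℝ) * Real.log (q 0) + _ ≤ _
    rw [hq0]
    linarith
  · obtain ⟨h1, h2, _, h3, _, h4⟩ := hball z (hsph hz)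
    have hzr : ‖z‖ = r := by
      rw [abs_of_pos hr.1] at hz; simpa using hz
    have hg1 : 0 < ‖g z‖ := norm_pos_iff.2 (Complex.slitPlane_ne_zero h4)
    have hcs : ‖g z‖ ^ 2 / q₀ ≤ opForm (T x) (Ψ z) := by
      rw [div_le_iff₀' hq₀pos]
      exact norm_inner_sq_le_opForm_mul hTx hpos' v (Ψ z)
    have ha : 0 < ‖g z‖ ^ 2 / q₀ := by positivity
    -- With `t = q z / (‖g z‖²/q₀)`, the inequality `1 - 1/t ≤ log t` leaves a remainder of at least
    -- `(n z + e z) / q z`, which is `n z / q₀` up to `o(‖z‖²)`.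
    have hlog := Real.one_sub_inv_le_log_of_pos (div_pos h3 ha)
    rw [Real.log_div h3.ne' ha.ne', Real.log_div (by positivity) hq₀pos.ne', Real.log_pow,
      inv_div] at hlog
    have h5 : (n z + e z) / q z ≤ 1 - ‖g z‖ ^ 2 / q₀ / q z := by
      rw [one_sub_div h3.ne']
      gcongr
      linarith
    rw [norm_pow, norm_norm, hzr] at h1
    have h6 := (abs_le.1 h1).1
    have h7 : n z / q₀ = 2 * ((2 * q₀)⁻¹ * n z) := by rw [mul_inv]; ring
    simp only [Pi.add_apply, Complex.log_re]
    push_cast at hlog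
    linarith

end LowerBound

/-! ## Germs and classes of sections -/

section Germs

variable {E : Type*} [NormedAddCommGroup E] [NormedSpace ℂ E]
  {S : Type} [TopologicalSpace S] [ChartedSpace E S]

theorem Sec.germ_res {G : HolPresheafMod E S} {U V : Opens S} (h : V ≤ U) {s : S} (hs : s ∈ V)
    (φ : Sec G U) : (Sec.res h φ).germ s hs = φ.germ s (h hs) :=
  TopCat.Presheaf.germ_res_apply (X := TopCat.of S) (C := Ab.{0}) G.presheaf (homOfLE h) s hs φ

theorem Sec.res_res {G : HolPresheafMod E S} {U V W : Opens S} (h : V ≤ U) (h' : W ≤ V)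
    (φ : Sec G U) : Sec.res h' (Sec.res h φ) = Sec.res (h'.trans h) φ :=
  (ConcreteCategory.congr_hom (G.presheaf.map_comp (homOfLE h).op (homOfLE h').op) φ).symm

theorem HolRing.germ_res {U V : Opens S} (h : V ≤ U) {s : S} (hs : s ∈ V)
    (f : HolRing E S U) : (HolRing.res h f).germ s hs = f.germ s (h hs) :=
  TopCat.Presheaf.germ_res_apply (X := TopCat.of S) (C := RingCat.{0})
    (holoSheaf E S).obj (homOfLE h) s hs f

theorem Sec.exists_res_eq_of_germ_eq {G : HolPresheafMod E S} {U V : Opens S} {s : S}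
    {hU : s ∈ U} {hV : s ∈ V} {φ : Sec G U} {ψ : Sec G V} (h : φ.germ s hU = ψ.germ s hV) :
    ∃ (W : Opens S) (_ : s ∈ W) (iU : W ≤ U) (iV : W ≤ V), Sec.res iU φ = Sec.res iV ψ := by
  obtain ⟨W, hW, iU, iV, e⟩ :=
    TopCat.Presheaf.germ_eq (X := TopCat.of S) (C := Ab.{0}) G.presheaf s hU hV φ ψ h
  exact ⟨W, hW, iU.le, iV.le, e⟩

theorem Sec.exists_germ_eq {G : HolPresheafMod E S} {s : S} (m : SecStalk G s) :
    ∃ (U : Opens S) (hs : s ∈ U) (φ : Sec G U), φ.germ s hs = m :=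
  TopCat.Presheaf.exists_germ_eq (X := TopCat.of S) (C := Ab.{0}) G.presheaf m

theorem HolRing.exists_germ_eq {s : S} (m : HolStalk E S s) :
    ∃ (U : Opens S) (hs : s ∈ U) (f : HolRing E S U), f.germ s hs = m :=
  TopCat.Presheaf.exists_germ_eq (X := TopCat.of S) (C := RingCat.{0}) (holoSheaf E S).obj m

theorem Sec.germ_add {G : HolPresheafMod E S} {U : Opens S} {s : S} (hs : s ∈ U)
    (φ ψ : Sec G U) : (φ + ψ).germ s hs = φ.germ s hs + ψ.germ s hs :=
  map_add (TopCat.Presheaf.germ (X := TopCat.of S) (C := Ab.{0}) G.presheaf U s hs).hom φ ψ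

theorem Sec.germ_smul {G : HolPresheafMod E S} {U : Opens S} {s : S} (hs : s ∈ U)
    (f : HolRing E S U) (φ : Sec G U) : (f • φ).germ s hs = f.germ s hs • φ.germ s hs :=
  PresheafOfModules.germ_ringCat_smul (X := TopCat.of S) (R := (holoSheaf E S).obj) G s U hs f φ

theorem HolRing.toMap_res {U V : Opens S} (h : V ≤ U) (f : HolRing E S U) (x : V) :
    (HolRing.res h f).toMap x = f.toMap ⟨x, h x.2⟩ := rfl

namespace SheafMetric

variable {F : HolSheafMod E S} (p : SheafMetric F)

theorem fn_zero {U : Opens S} (x : U) : p.fn (0 : Sec F.val U) x = 0 := by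
  rw [(p.fn_eq_zero (0 : Sec F.val U)).2 rfl]; rfl

/-- A generator `f • γ` has size `|f(s)| p(γ)(s) = 0` at `s`, and this survives sums and multiples.
It makes the size at `s` a function of the class alone. -/
theorem exists_germ_of_mem_vanishing {s : S} {m : SecStalk F.val s}
    (hm : m ∈ p.normed.vanishing s) :
    ∃ (U : Opens S) (hs : s ∈ U) (φ : Sec F.val U), φ.germ s hs = m ∧ p.fn φ ⟨s, hs⟩ = 0 := by
  rw [NormedSections.vanishing] at hm
  induction hm using Submodule.span_induction with
  | mem m h =>
    obtain ⟨f, ⟨U, hU, f, hf, rfl⟩, V, hV, γ, -, rfl⟩ := h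
    refine ⟨U ⊓ V, ⟨hU, hV⟩, HolRing.res (inf_le_left : U ⊓ V ≤ U) f •
      Sec.res (inf_le_right : U ⊓ V ≤ V) γ, ?_, ?_⟩
    · exact (Sec.germ_smul _ _ _).trans
        (congrArg₂ (· • ·) (HolRing.germ_res _ _ f) (Sec.germ_res _ _ γ))
    · rw [p.fn_smul, HolRing.toMap_res, hf, nnnorm_zero, zero_mul]
  | zero =>
    exact ⟨⊤, trivial, 0, map_zero (TopCat.Presheaf.germ (X := TopCat.of S) (C := Ab.{0})
      F.val.presheaf ⊤ s trivial).hom, p.fn_zero _⟩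
  | add m m' _ _ h h' =>
    obtain ⟨U, hU, φ, rfl, hφ⟩ := h
    obtain ⟨V, hV, ψ, rfl, hψ⟩ := h'
    refine ⟨U ⊓ V, ⟨hU, hV⟩, Sec.res (inf_le_left : U ⊓ V ≤ U) φ +
      Sec.res (inf_le_right : U ⊓ V ≤ V) ψ, ?_, ?_⟩
    · exact (Sec.germ_add _ _ _).trans
        (congrArg₂ (· + ·) (Sec.germ_res _ _ φ) (Sec.germ_res _ _ ψ))
    · refine le_antisymm ((p.fn_add _ _ _).trans ?_) zero_le
      rw [p.fn_res, p.fn_res, hφ, hψ, zero_add]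
  | smul a m _ h =>
    obtain ⟨U, hU, φ, rfl, hφ⟩ := h
    obtain ⟨V, hV, f, rfl⟩ := HolRing.exists_germ_eq a
    refine ⟨V ⊓ U, ⟨hV, hU⟩, HolRing.res (inf_le_left : V ⊓ U ≤ V) f •
      Sec.res (inf_le_right : V ⊓ U ≤ U) φ, ?_, ?_⟩
    · exact (Sec.germ_smul _ _ _).trans
        (congrArg₂ (· • ·) (HolRing.germ_res _ _ f) (Sec.germ_res _ _ φ))
    · rw [p.fn_smul, p.fn_res, hφ, mul_zero]

/-- Two sections of the same class differ near the point by a section of size zero there. -/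
theorem exists_sub_of_cls_eq {U V : Opens S} {s : S} {hU : s ∈ U} {hV : s ∈ V} {φ : Sec F.val U}
    {ψ : Sec F.val V} (h : p.normed.cls s hU φ = p.normed.cls s hV ψ) :
    ∃ (W : Opens S) (hW : s ∈ W) (iU : W ≤ U) (iV : W ≤ V) (χ : Sec F.val W),
      Sec.res iU φ = Sec.res iV ψ + χ ∧ p.fn χ ⟨s, hW⟩ = 0 := by
  have h1 : φ.germ s hU - ψ.germ s hV ∈ p.normed.vanishing s := (Submodule.Quotient.eq _).1 h
  obtain ⟨A, hA, χ, hχ, hχ0⟩ := p.exists_germ_of_mem_vanishing h1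
  have hs : s ∈ U ⊓ (V ⊓ A) := ⟨hU, hV, hA⟩
  have h2 : (Sec.res (inf_le_left : U ⊓ (V ⊓ A) ≤ U) φ).germ s hs =
      (Sec.res (inf_le_right.trans inf_le_left : U ⊓ (V ⊓ A) ≤ V) ψ +
        Sec.res (inf_le_right.trans inf_le_right : U ⊓ (V ⊓ A) ≤ A) χ).germ s hs := by
    refine Eq.trans ?_ (Sec.germ_add _ _ _).symm
    rw [Sec.germ_res, Sec.germ_res, Sec.germ_res, hχ, add_sub_cancel]
  obtain ⟨W, hW, iU, iV, e⟩ := Sec.exists_res_eq_of_germ_eq h2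
  refine ⟨W, hW, iU.trans inf_le_left, iU.trans (inf_le_right.trans inf_le_left),
    Sec.res (iU.trans (inf_le_right.trans inf_le_right)) χ, ?_, ?_⟩
  · have e1 := e
    rw [map_add, Sec.res_res, Sec.res_res, Sec.res_res] at e1
    exact e1
  · rw [p.fn_res]; exact hχ0

theorem fn_eq_of_cls_eq {U V : Opens S} {s : S} {hU : s ∈ U} {hV : s ∈ V} {φ : Sec F.val U}
    {ψ : Sec F.val V} (h : p.normed.cls s hU φ = p.normed.cls s hV ψ) :
    p.fn φ ⟨s, hU⟩ = p.fn ψ ⟨s, hV⟩ := by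
  have key : ∀ {U V : Opens S} {hU : s ∈ U} {hV : s ∈ V} {φ : Sec F.val U}
      {ψ : Sec F.val V}, p.normed.cls s hU φ = p.normed.cls s hV ψ →
      p.fn φ ⟨s, hU⟩ ≤ p.fn ψ ⟨s, hV⟩ := by
    intro U V hU hV φ ψ h
    obtain ⟨W, hW, iU, iV, χ, e, hχ⟩ := p.exists_sub_of_cls_eq h
    rw [← p.fn_res iU φ ⟨s, hW⟩, e, ← p.fn_res iV ψ ⟨s, hW⟩]
    exact (p.fn_add _ _ _).trans (by rw [hχ, add_zero])
  exact le_antisymm (key h) (key h.symm)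

/-- The class of a section, as an element of the fibre. -/
def fibreMk {U : Opens S} (s : S) (hs : s ∈ U) (φ : Sec F.val U) : p.normed.Fibre s :=
  ⟨p.normed.cls s hs φ, U, hs, φ, trivial, rfl⟩

theorem fibreNorm_fibreMk {U : Opens S} (s : S) (hs : s ∈ U) (φ : Sec F.val U) :
    p.normed.fibreNorm s (p.fibreMk s hs φ) = p.fn φ ⟨s, hs⟩ := by
  refine le_antisymm ?_ ?_
  · exact iInf_le_of_le U (iInf_le_of_le hs (iInf_le_of_le φ (iInf_le_of_le trivial
      (iInf_le_of_le rfl le_rfl))))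
  · refine le_iInf fun V => le_iInf fun hV => le_iInf fun ψ => le_iInf fun _ => le_iInf fun h => ?_
    have := p.fn_eq_of_cls_eq h
    change ((p.fn φ ⟨s, hs⟩ : ℝ≥0) : ℝ≥0∞) ≤ (p.fn ψ ⟨s, hV⟩ : ℝ≥0)
    rw [this]

theorem logSize_normed {U : Opens S} (φ : Sec F.val U) {y : S} (hy : y ∈ U) :
    p.normed.logSize U φ y = Real.log (p.fn φ ⟨y, hy⟩) := by
  have := Subtype.val_injective.extend_apply
    (fun x : U => Real.log ((p.fn φ x : ℝ≥0∞)).toReal) 0 ⟨y, hy⟩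
  rw [ENNReal.coe_toReal] at this
  exact this

end SheafMetric

end Germs

/-! ## The norm of homomorphisms -/

section HomNorm

variable {E : Type*} [NormedAddCommGroup E] [NormedSpace ℂ E]
  {S : Type} [TopologicalSpace S] [ChartedSpace E S] {F F' : HolSheafMod E S}
  (p : SheafMetric F) (p' : SheafMetric F') {U : Opens S} (α : HomOn F F' U)

/-- The inequalities defining admissible constants are closed in `a`, so they persist as `a`
decreases to the infimum: a finite norm is itself admissible. -/
theorem fn_app_le_homNorm_mul {x : U} (hx : homNorm p p' α x ≠ ⊤) {V : Opens S} (hV : V ≤ U)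
    (hs : x.1 ∈ V) (φ : Sec F.val V) :
    (p'.fn (α.app V hV φ) ⟨x, hs⟩ : ℝ) ≤ (homNorm p p' α x).toReal * p.fn φ ⟨x, hs⟩ := by
  have key : ∀ a : ℝ≥0, homNorm p p' α x < a →
      p'.fn (α.app V hV φ) ⟨x, hs⟩ ≤ a * p.fn φ ⟨x, hs⟩ := by
    intro a ha
    obtain ⟨b, hb⟩ := iInf_lt_iff.1 ha
    obtain ⟨hb', hba⟩ := iInf_lt_iff.1 hb
    refine (hb' V hV hs φ).trans ?_
    gcongr
    exact (ENNReal.coe_lt_coe.1 hba).le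
  set N := (homNorm p p' α x).toNNReal with hN
  have hN' : homNorm p p' α x = N := (ENNReal.coe_toNNReal hx).symm
  have h2 : p'.fn (α.app V hV φ) ⟨x, hs⟩ ≤ N * p.fn φ ⟨x, hs⟩ := by
    have h3 : Tendsto (fun a : ℝ≥0 => a * p.fn φ ⟨x, hs⟩) (𝓝[>] N) (𝓝 (N * p.fn φ ⟨x, hs⟩)) := by
      have : Continuous fun a : ℝ≥0 => a * p.fn φ ⟨x, hs⟩ := by fun_prop
      exact this.continuousWithinAt.tendsto
    refine ge_of_tendsto h3 ?_
    filter_upwards [self_mem_nhdsWithin] with a ha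
    refine key a ?_
    rw [hN']; exact_mod_cast ha
  rw [hN', ENNReal.coe_toReal]
  exact_mod_cast h2

theorem exists_lt_fn_app {x : U} {b : ℝ≥0} (hb : (b : ℝ≥0∞) < homNorm p p' α x) :
    ∃ (V : Opens S) (hV : V ≤ U) (hs : x.1 ∈ V) (φ : Sec F.val V),
      (b : ℝ) * p.fn φ ⟨x, hs⟩ < p'.fn (α.app V hV φ) ⟨x, hs⟩ := by
  by_contra! h
  refine absurd hb (not_lt.2 ?_)
  refine iInf_le_of_le b (iInf_le_of_le (fun V hV hs φ => ?_) le_rfl)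
  exact_mod_cast h V hV hs φ

/-- Finiteness of the norm forces the image of a section of size zero at `x` to have size zero
there. Hence a nearly extremal section may be exchanged for any other with the same value at the
point. -/
theorem fn_app_le_of_sub {x : U} (hx : homNorm p p' α x ≠ ⊤) {V : Opens S} (hV : V ≤ U)
    (hs : x.1 ∈ V) {φ ψ χ : Sec F.val V} (e : φ = ψ + χ) (hχ : p.fn χ ⟨x, hs⟩ = 0) :
    p'.fn (α.app V hV φ) ⟨x, hs⟩ ≤ p'.fn (α.app V hV ψ) ⟨x, hs⟩ := by
  have h1 := fn_app_le_homNorm_mul p p' α hx hV hs χ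
  rw [hχ, NNReal.coe_zero, mul_zero] at h1
  have h2 : p'.fn (α.app V hV χ) ⟨x, hs⟩ = 0 := by
    exact_mod_cast le_antisymm h1 (NNReal.coe_nonneg _)
  rw [e, map_add]
  exact (p'.fn_add _ _ _).trans (by rw [h2, add_zero])

theorem logSize_homMetric {y : S} (hy : y ∈ U) :
    (homMetric p p').logSize U α y = Real.log (homNorm p p' α ⟨y, hy⟩).toReal :=
  Subtype.val_injective.extend_apply
    (fun x : U => Real.log (homNorm p p' α x).toReal) 0 ⟨y, hy⟩

end HomNorm

/-! ## The curvature inequality along a disc -/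

section Disc

theorem lambdaOp_congr {u u' : ℂ → ℝ} {a : ℂ} (h : u =ᶠ[𝓝 a] u') : lambdaOp u a = lambdaOp u' a := by
  obtain ⟨δ, hδ, hball⟩ := Metric.eventually_nhds_iff_ball.1 h
  refine limsup_congr ?_
  filter_upwards [Ioo_mem_nhdsGT hδ] with r hr
  rw [h.self_of_nhds, Real.circleAverage_congr_sphere (f₁ := u) (f₂ := u')]
  intro z hz
  refine hball z ?_
  rw [abs_of_pos hr.1] at hz
  exact Metric.sphere_subset_ball hr.2 hz

theorem lambdaOp_comp_add (u : ℂ → ℝ) (a : ℂ) : lambdaOp (fun z => u (a + z)) 0 = lambdaOp u a := by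
  unfold lambdaOp
  have : ∀ r, Real.circleAverage (fun z => u (a + z)) 0 r = Real.circleAverage u a r := by
    intro r
    rw [← Real.circleAverage_map_add_const (f := u) (c := a)]
    congr 1
    ext z
    rw [add_comm]
  simp only [this, add_zero]

/-- The term `c‖z‖²` shifts the difference quotient by exactly `c` at every small radius, hence also
shifts the limsup. -/
theorem le_lambdaOp_add_norm_sq {u : ℂ → ℝ} {a : ℂ} (hu : ∀ᶠ z in 𝓝 a, ContinuousAt u z)
    {b c : ℝ} (h : (b : EReal) ≤ lambdaOp u a) :
    ((b + c : ℝ) : EReal) ≤ lambdaOp (fun z => u z + c * ‖z‖ ^ 2) a := by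
  obtain ⟨δ, hδ, hball⟩ := Metric.eventually_nhds_iff_ball.1 hu
  rw [← EReal.ge_of_forall_gt_iff_ge]
  intro y hy
  have hy' : y - c < b := by linarith [EReal.coe_lt_coe_iff.1 hy]
  have h1 : ((y - c : ℝ) : EReal) < lambdaOp u a := (EReal.coe_lt_coe_iff.2 hy').trans_le h
  have h2 := frequently_lt_of_lt_limsup (by isBoundedDefault) h1
  refine le_limsup_of_frequently_le ?_ (by isBoundedDefault)
  refine (h2.and_eventually (Ioo_mem_nhdsGT hδ)).mono fun r hr => ?_
  obtain ⟨h3, hr⟩ := hr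
  rw [EReal.coe_lt_coe_iff] at h3
  rw [EReal.coe_le_coe_iff]
  have hint : CircleIntegrable u a r := by
    refine ContinuousOn.circleIntegrable' fun z hz => (hball z ?_).continuousWithinAt
    rw [abs_of_pos hr.1] at hz
    exact Metric.sphere_subset_ball hr.2 hz
  have h4 := circleAverage_add_norm_sq (δ := c) (F := fun _ => 0) hint (by fun_prop)
  simp only [Complex.zero_re, add_zero] at h4
  rw [h4]
  have hr0 : 0 < r ^ 2 := by have := hr.1; positivity
  have h5 : (r ^ 2)⁻¹ * (Real.circleAverage u a r + c * ‖a‖ ^ 2 + c * r ^ 2 - (u a + c * ‖a‖ ^ 2)) =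
      (r ^ 2)⁻¹ * (Real.circleAverage u a r - u a) + c := by
    have hrne : r ≠ 0 := hr.1.ne'
    field_simp
    ring
  rw [h5]
  linarith

theorem zero_le_lambdaOp_of_min {u : ℂ → ℝ} {a : ℂ} (hu : ∀ᶠ z in 𝓝 a, ContinuousAt u z)
    (h : ∀ᶠ z in 𝓝 a, u a ≤ u z) : 0 ≤ lambdaOp u a := by
  rw [← EReal.coe_zero]
  refine le_lambdaOp_of_circleAverage fun ε hε => ?_
  obtain ⟨δ, hδ, hball⟩ := Metric.eventually_nhds_iff_ball.1 (hu.and h)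
  filter_upwards [Ioo_mem_nhdsGT hδ] with r hr
  have hsub : Metric.sphere a |r| ⊆ Metric.ball a δ := by
    rw [abs_of_pos hr.1]; exact Metric.sphere_subset_ball hr.2
  have h1 : Real.circleAverage (fun _ => u a) a r ≤ Real.circleAverage u a r :=
    Real.circleAverage_mono (circleIntegrable_const _ _ _)
      (ContinuousOn.circleIntegrable' fun z hz => (hball z (hsub hz)).1.continuousWithinAt)
      fun z hz => (hball z (hsub hz)).2
  rw [Real.circleAverage_const] at h1
  have : 0 ≤ r ^ 2 * ε := by positivity
  linarith

/-- A sub-mean value inequality for `log w`, where `w` may vanish. -/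
theorem log_le_circleAverage {w B : ℂ → ℝ} {b r : ℝ} (hr : 0 < r)
    (hw : ∀ z ∈ Metric.closedBall (0 : ℂ) r, ContinuousAt w z)
    (hB : ContinuousOn B (Metric.closedBall 0 r))
    (hwB : ∀ z ∈ Metric.closedBall (0 : ℂ) r, w z ≤ Real.exp (B z)) (hw0 : 0 < w 0)
    (hL : ∀ z ∈ Metric.ball (0 : ℂ) r, 0 < w z → (b : EReal) ≤ lambdaOp (fun y => Real.log (w y)) z) :
    Real.log (w 0) ≤ Real.circleAverage B 0 r - r ^ 2 * b := by
  have hB2 : ContinuousOn (fun z => B z + (-b) * ‖z‖ ^ 2) (Metric.closedBall 0 r) :=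
    hB.add (by fun_prop)
  obtain ⟨a, -, hmin⟩ := (isCompact_closedBall (0 : ℂ) r).exists_isMinOn ⟨0, by simp [hr.le]⟩ hB2
  -- `M` is the minimum of `B - b‖z‖²` on the disc. Truncating `log w - b‖z‖²` from below at `M`
  -- removes the zeros of `w` and preserves the upper bound by `B - b‖z‖²`.
  set M : ℝ := B a + (-b) * ‖a‖ ^ 2 with hM
  set k : ℂ → ℝ := fun z => Real.exp (M - (-b) * ‖z‖ ^ 2) with hk
  have hkc : Continuous k := by fun_prop
  set U : ℂ → ℝ := fun z => Real.log (max (w z) (k z)) + (-b) * ‖z‖ ^ 2 with hU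
  have hmaxpos : ∀ z, 0 < max (w z) (k z) := fun z => lt_max_of_lt_right (Real.exp_pos _)
  have hUc : ∀ z ∈ Metric.closedBall (0 : ℂ) r, ContinuousAt U z := fun z hz =>
    (((hw z hz).max hkc.continuousAt).log (hmaxpos z).ne').add (Continuous.continuousAt (by fun_prop))
  have hMU : ∀ z, M ≤ U z := by
    intro z
    have : Real.log (k z) ≤ Real.log (max (w z) (k z)) :=
      Real.log_le_log (Real.exp_pos _) (le_max_right _ _)
    simp only [hk, Real.log_exp] at this
    simp only [hU, hk]
    linarith
  have hUB : ∀ z ∈ Metric.closedBall (0 : ℂ) r, U z ≤ B z + (-b) * ‖z‖ ^ 2 := by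
    intro z hz
    have h1 : M ≤ B z + (-b) * ‖z‖ ^ 2 := hmin hz
    have : max (w z) (k z) ≤ Real.exp (B z) :=
      max_le (hwB z hz) (Real.exp_le_exp.2 (by linarith))
    have h2 := Real.log_le_log (hmaxpos z) this
    rw [Real.log_exp] at h2
    simp only [hU]
    linarith
  have hsub := le_circleAverage_of_lambdaOp_nonneg hr
    (fun z hz => (hUc z hz).continuousWithinAt) (fun z hz => ?_)
  · have hint : CircleIntegrable B 0 r := hB.circleIntegrable_of_closedBall (by rw [abs_of_pos hr])
    have hUint : CircleIntegrable U 0 r :=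
      ContinuousOn.circleIntegrable_of_closedBall
        (fun z hz => (hUc z hz).continuousWithinAt) (by rw [abs_of_pos hr])
    have h1 : Real.circleAverage U 0 r ≤
        Real.circleAverage (fun z => B z + (-b) * ‖z‖ ^ 2) 0 r := by
      refine Real.circleAverage_mono hUint
        (hB2.circleIntegrable_of_closedBall (by rw [abs_of_pos hr])) fun z hz => ?_
      rw [abs_of_pos hr] at hz
      exact hUB z (Metric.sphere_subset_closedBall hz)
    have h4 := circleAverage_add_norm_sq (δ := -b) (F := fun _ => 0) hint (by fun_prop)
    simp only [Complex.zero_re, add_zero, norm_zero] at h4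
    rw [h4] at h1
    have h5 : Real.log (w 0) ≤ U 0 := by
      have := Real.log_le_log hw0 (le_max_left (w 0) (k 0))
      simpa [hU] using this
    nlinarith
  · have hzc := Metric.ball_subset_closedBall hz
    have hnear : ∀ᶠ y in 𝓝 z, y ∈ Metric.closedBall (0 : ℂ) r :=
      mem_of_superset (Metric.isOpen_ball.mem_nhds hz) Metric.ball_subset_closedBall
    -- Either the truncation is inactive near `z` and the hypothesis on `log w` applies, or `U z =
    -- M` is a minimum of `U`, where `Λ U ≥ 0` is automatic.
    rcases lt_or_ge (k z) (w z) with h | h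
    · have hwz : 0 < w z := (Real.exp_pos _).trans h
      have hwev : ∀ᶠ y in 𝓝 z, k y < w y :=
        hkc.continuousAt.eventually_lt (hw z hzc) h
      have hlogc : ∀ᶠ y in 𝓝 z, ContinuousAt (fun y => Real.log (w y)) y := by
        filter_upwards [hwev, hnear] with y h1 h2
        exact (hw y h2).log ((Real.exp_pos _).trans h1).ne'
      have h1 := le_lambdaOp_add_norm_sq (c := -b) hlogc (hL z hz hwz)
      rw [add_neg_cancel, EReal.coe_zero] at h1
      rwa [lambdaOp_congr (u' := fun y => Real.log (w y) + (-b) * ‖y‖ ^ 2)]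
      filter_upwards [hwev] with y hy
      simp only [hU, max_eq_left hy.le]
    · refine zero_le_lambdaOp_of_min (hnear.mono hUc) (Eventually.of_forall fun y => ?_)
      have : U z = M := by
        simp only [hU]
        rw [max_eq_right h]
        simp only [hk, Real.log_exp]
        ring
      rw [this]; exact hMU y

variable {E : Type*} [NormedAddCommGroup E] [NormedSpace ℂ E]
  {V : Type*} [NormedAddCommGroup V] [InnerProductSpace ℂ V] [CompleteSpace V]

/-- Along a disc `G`, let `w v` be the size of the image of the section `(1 - T⁻¹ ∂T) v` under a
homomorphism of norm `exp ℓ`. If the Levi form of `log (w v)` dominates that of the metric `T`,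
then `Λ ℓ ≥ 0` at the centre. -/
theorem zero_le_lambdaOp_of_family {T : E → V →L[ℂ] V} {x : E} (hT : ContDiffAt ℝ 2 T x)
    (hsa : ∀ᶠ y in 𝓝 x, IsSelfAdjoint (T y)) (hu : IsUnit (T x))
    (hpos : ∀ v, v ≠ 0 → 0 < opForm (T x) v) {G : ℂ → E} (hG : ContDiffAt ℂ 1 G 0) (hGx : G 0 = x)
    {ℓ : ℂ → ℝ} (hℓ : ∀ᶠ z in 𝓝 0, ContinuousAt ℓ z) {w : V → ℂ → ℝ}
    (hw : ∀ᶠ z in 𝓝 0, ∀ v, ContinuousAt (w v) z ∧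
      w v z ≤ Real.exp (ℓ z) * √(opForm (T (G z)) (v - connForm T x (G z - x) v)))
    (hL : ∀ m v₁, v₁ ≠ 0 → (∀ᶠ z in 𝓝 0,
        m * opForm (T (G z)) v₁ ≤ opForm (leviOp T (G z) (deriv G z)) v₁) →
      ∀ᶠ z in 𝓝 0, ∀ v, 0 < w v z →
        (((1 / 2 : ℝ) * m : ℝ) : EReal) ≤ lambdaOp (fun y => Real.log (w v y)) z)
    (hsup : ∀ η > 0, ∃ v, v ≠ 0 ∧ Real.exp (ℓ 0 - η) * √(opForm (T x) v) ≤ w v 0) :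
    0 ≤ lambdaOp ℓ 0 := by
  set ξ := deriv G 0 with hξ
  have hGev : ∀ᶠ z in 𝓝 0, ContDiffAt ℂ 1 G z := hG.eventually (by norm_num)
  have hGd : HasDerivAt G ξ 0 := (hG.differentiableAt (by norm_num)).hasDerivAt
  have hGc : ∀ᶠ z in 𝓝 0, ContinuousAt G z := hGev.mono fun z hz => hz.continuousAt
  have hGtend : Tendsto G (𝓝 0) (𝓝 x) := by simpa [hGx] using hG.continuousAt.tendsto
  have hdGc : ContinuousAt (deriv G) 0 := by
    have h1 : ContinuousAt (fderiv ℂ G) 0 := (hG.fderiv_right (m := 0) (by norm_num)).continuousAt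
    exact h1.clm_apply continuousAt_const
  obtain ⟨c, hc, hcoer⟩ := exists_pos_mul_norm_sq_le_opForm hsa.self_of_nhds hu hpos
  obtain ⟨v₀, hv₀, -⟩ := hsup 1 one_pos
  set Q : Set ℝ := {m | ∃ v, v ≠ 0 ∧ m = opForm (leviOp T x ξ) v / opForm (T x) v} with hQ
  have hQbdd : BddAbove Q := by
    refine ⟨‖leviOp T x ξ‖ / c, ?_⟩
    rintro _ ⟨v, hv, rfl⟩
    rw [div_le_iff₀ (hpos v hv)]
    calc _ ≤ ‖leviOp T x ξ‖ * ‖v‖ ^ 2 := (le_abs_self _).trans (abs_opForm_le _ _)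
      _ = ‖leviOp T x ξ‖ / c * (c * ‖v‖ ^ 2) := by field_simp
      _ ≤ _ := by gcongr; exact hcoer v
  have hQne : Q.Nonempty := ⟨_, v₀, hv₀, rfl⟩
  set m := sSup Q with hm
  have hmle : ∀ v, opForm (leviOp T x ξ) v ≤ m * opForm (T x) v := by
    intro v
    rcases eq_or_ne v 0 with rfl | hv
    · simp
    · rw [← div_le_iff₀ (hpos v hv)]
      exact le_csSup hQbdd ⟨v, hv, rfl⟩
  rw [← EReal.coe_zero]
  refine le_lambdaOp_of_circleAverage fun ε hε => ?_
  -- A single vector with ratio above `m - ε` at the centre is enough: its ratio stays at least `m -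
  -- ε` nearby by continuity.
  obtain ⟨_, ⟨v₁, hv₁, rfl⟩, hv₁m⟩ := exists_lt_of_lt_csSup hQne (sub_lt_self m hε)
  rw [lt_div_iff₀ (hpos v₁ hv₁)] at hv₁m
  have hnear : ∀ᶠ z in 𝓝 0,
      (m - ε) * opForm (T (G z)) v₁ ≤ opForm (leviOp T (G z) (deriv G z)) v₁ := by
    have h1 : ContinuousAt (fun z => (m - ε) * opForm (T (G z)) v₁) 0 := by
      have : ContinuousAt (fun z => opFormCLM v₁ (T (G z))) 0 := by
        refine (opFormCLM v₁).continuous.continuousAt.comp ?_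
        refine ContinuousAt.comp ?_ hG.continuousAt
        rw [hGx]; exact hT.continuousAt
      exact continuousAt_const.mul this
    have h2 : ContinuousAt (fun z => opForm (leviOp T (G z) (deriv G z)) v₁) 0 := by
      have h3 : ContinuousAt (fun z => leviOp T (G z) (deriv G z)) 0 :=
        continuousAt_leviOp (by rw [hGx]; exact hT) (by rw [hGx]; exact hu) hG.continuousAt hdGc
      exact (opFormCLM v₁).continuous.continuousAt.comp h3
    refine (h1.eventually_lt h2 ?_).mono fun z hz => hz.le
    rw [hGx]; exact hv₁m
  have hΛ := hL (m - ε) v₁ hv₁ hnear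
  obtain ⟨δ₁, hδ₁, hup⟩ := eventually_circleAverage_log_le hT hsa hu hpos hGd hGc hGx hmle hε
  have hTG : ∀ᶠ z in 𝓝 (0 : ℂ), ContinuousAt (fun z => T (G z)) z := by
    have h1 : ∀ᶠ y in 𝓝 x, ContinuousAt T y :=
      (hT.eventually (by norm_num)).mono fun y hy => hy.continuousAt
    filter_upwards [hGtend.eventually h1, hGc] with z hz hz'
    exact hz.comp hz'
  obtain ⟨δ₂, hδ₂, hball⟩ := Metric.eventually_nhds_iff_ball.1
    (hΛ.and (hℓ.and (hw.and (hTG.and hGc))))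
  filter_upwards [Ioo_mem_nhdsGT (lt_min hδ₁ hδ₂)] with r hr
  have hr1 : r < δ₁ := hr.2.trans_le (min_le_left _ _)
  have hr2 : r < δ₂ := hr.2.trans_le (min_le_right _ _)
  have hcl1 : Metric.closedBall (0 : ℂ) r ⊆ Metric.ball 0 δ₁ := Metric.closedBall_subset_ball hr1
  have hcl2 : Metric.closedBall (0 : ℂ) r ⊆ Metric.ball 0 δ₂ := Metric.closedBall_subset_ball hr2
  -- The radius is fixed before `η`. This is legitimate because `δ₁` and `δ₂` do not depend on `v`,
  -- whereas the nearly extremal `v` depends on `η`.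
  suffices H : ∀ η > 0, ℓ 0 - η ≤ Real.circleAverage ℓ 0 r + r ^ 2 * ε by
    have : ℓ 0 ≤ Real.circleAverage ℓ 0 r + r ^ 2 * ε :=
      le_of_forall_pos_le_add fun η hη => by linarith [H η hη]
    linarith
  intro η hη
  obtain ⟨v, hv, hvw⟩ := hsup η hη
  obtain ⟨hvpos, hvavg⟩ := hup v hv
  set L : ℂ → ℝ := fun z =>
    (1 / 2 : ℝ) * Real.log (opForm (T (G z)) (v - connForm T x (G z - x) v)) with hLdef
  have hLc : ContinuousOn L (Metric.closedBall 0 r) := by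
    intro z hz
    obtain ⟨_, _, _, h1, h2⟩ := hball z (hcl2 hz)
    refine ContinuousAt.continuousWithinAt (continuousAt_const.mul (ContinuousAt.log ?_
      (hvpos z (hcl1 hz)).ne'))
    have h3 : ContinuousAt (fun z => v - connForm T x (G z - x) v) z :=
      continuousAt_const.sub (((connForm T x).continuous.continuousAt.comp
        (h2.sub continuousAt_const)).clm_apply continuousAt_const)
    exact ContinuousAt.comp (f := fun z => (T (G z), v - connForm T x (G z - x) v))
      continuous_opForm.continuousAt (h1.prodMk h3)
  have hℓc : ContinuousOn ℓ (Metric.closedBall 0 r) := fun z hz =>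
    (hball z (hcl2 hz)).2.1.continuousWithinAt
  have hsqrt : ∀ y : ℝ, 0 < y → √y = Real.exp ((1 / 2 : ℝ) * Real.log y) := by
    intro y hy
    rw [Real.sqrt_eq_rpow, Real.rpow_def_of_pos hy, mul_comm]
  have hq₀ := hpos v hv
  have hw0 : Real.exp (ℓ 0 - η + (1 / 2 : ℝ) * Real.log (opForm (T x) v)) ≤ w v 0 := by
    rw [Real.exp_add, ← hsqrt _ hq₀]; exact hvw
  have hw0pos : 0 < w v 0 := (Real.exp_pos _).trans_le hw0
  -- Here `B` is `ℓ` plus the logarithm of the size of the section. Together with `hvavg`, the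
  -- contributions `∓ r²m/2` cancel and `r²ε` remains.
  have hmain := log_le_circleAverage (w := w v) (B := fun z => ℓ z + L z) (b := (1 / 2) * (m - ε))
    hr.1 (fun z hz => ((hball z (hcl2 hz)).2.2.1 v).1) (hℓc.add hLc)
    (fun z hz => by
      rw [Real.exp_add, ← hsqrt _ (hvpos z (hcl1 hz))]
      exact ((hball z (hcl2 hz)).2.2.1 v).2) hw0pos
    (fun z hz => (hball z (hcl2 (Metric.ball_subset_closedBall hz))).1 v)
  rw [Real.circleAverage_fun_add
    (hℓc.circleIntegrable_of_closedBall (by rw [abs_of_pos hr.1]))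
    (hLc.circleIntegrable_of_closedBall (by rw [abs_of_pos hr.1]))] at hmain
  have h1 := (Real.le_log_iff_exp_le hw0pos).2 hw0
  have h2 := hvavg r ⟨hr.1, hr1⟩
  linarith

end Disc

/-! ## Griffiths curvature and its bounds -/

section CurvatureBounds

theorem half_mul_le_of_le_two_mul {m : ℝ} {a : EReal} (h : (m : EReal) ≤ 2 * a) :
    (((1 / 2 : ℝ) * m : ℝ) : EReal) ≤ a := by
  have h2 : (2 : EReal) = ((2 : ℝ) : EReal) := rfl
  induction a with
  | bot =>
    rw [h2, EReal.coe_mul_bot_of_pos two_pos] at h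
    exact absurd h (not_le.2 (EReal.bot_lt_coe m))
  | top => exact le_top
  | coe a =>
    rw [h2, ← EReal.coe_mul, EReal.coe_le_coe_iff] at h
    rw [EReal.coe_le_coe_iff]
    linarith

theorem le_two_mul_of_half_mul_le {m : ℝ} {a : EReal} (h : (((1 / 2 : ℝ) * m : ℝ) : EReal) ≤ a) :
    (m : EReal) ≤ 2 * a := by
  have h2 : (2 : EReal) = ((2 : ℝ) : EReal) := rfl
  induction a with
  | bot => exact absurd h (not_le.2 (EReal.bot_lt_coe _))
  | top => rw [h2, EReal.coe_mul_top_of_pos two_pos]; exact le_top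
  | coe a =>
    rw [h2, ← EReal.coe_mul, EReal.coe_le_coe_iff]
    rw [EReal.coe_le_coe_iff] at h
    linarith

variable {E : Type*} [NormedAddCommGroup E] [NormedSpace ℂ E]
  {S : Type} [TopologicalSpace S] [ChartedSpace E S]

namespace NormedSections

variable {G : HolPresheafMod E S} (N : NormedSections G)

theorem griffiths_le_neg {s : S} {ξ : TangentSpace 𝓘(ℂ, E) s} {v : N.Fibre s} {m : ℝ}
    (h : ∀ (U : Opens S) (hs : s ∈ U) (φ : Sec G U), N.mem U φ → N.cls s hs φ = v.1 →
      ∀ f : ℂ → S, ContMDiffAt 𝓘(ℂ) 𝓘(ℂ, E) ω f 0 →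
        (⟨f 0, mfderiv 𝓘(ℂ) 𝓘(ℂ, E) f 0 (1 : ℂ)⟩ : TangentBundle 𝓘(ℂ, E) S) = ⟨s, ξ⟩ →
        (((1 / 2 : ℝ) * m : ℝ) : EReal) ≤ lambdaOp (N.logSize U φ ∘ f) 0) :
    N.griffiths s ξ v ≤ ((-m : ℝ) : EReal) := by
  rw [griffiths, EReal.coe_neg, EReal.neg_le_neg_iff]
  refine le_two_mul_of_half_mul_le ?_
  exact le_iInf fun U => le_iInf fun hs => le_iInf fun φ => le_iInf fun hm => le_iInf fun hc =>
    le_iInf fun f => le_iInf fun hf => le_iInf fun hf' => h U hs φ hm hc f hf hf'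

theorem le_lambdaOp_of_griffiths_le {s : S} {ξ : TangentSpace 𝓘(ℂ, E) s} {v : N.Fibre s} {m : ℝ}
    (h : N.griffiths s ξ v ≤ ((-m : ℝ) : EReal)) {U : Opens S} {hs : s ∈ U} {φ : Sec G U}
    (hm : N.mem U φ) (hc : N.cls s hs φ = v.1) {f : ℂ → S}
    (hf : ContMDiffAt 𝓘(ℂ) 𝓘(ℂ, E) ω f 0)
    (hf' : (⟨f 0, mfderiv 𝓘(ℂ) 𝓘(ℂ, E) f 0 (1 : ℂ)⟩ : TangentBundle 𝓘(ℂ, E) S) = ⟨s, ξ⟩) :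
    (((1 / 2 : ℝ) * m : ℝ) : EReal) ≤ lambdaOp (N.logSize U φ ∘ f) 0 := by
  rw [griffiths, EReal.coe_neg, EReal.neg_le_neg_iff] at h
  refine (half_mul_le_of_le_two_mul h).trans ?_
  exact iInf_le_of_le U (iInf_le_of_le hs (iInf_le_of_le φ (iInf_le_of_le hm (iInf_le_of_le hc
    (iInf_le_of_le f (iInf_le_of_le hf (iInf_le_of_le hf' le_rfl)))))))

end NormedSections

end CurvatureBounds

/-! ## Discs and charts -/

section Charts

variable {E : Type*} [NormedAddCommGroup E] [NormedSpace ℂ E]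
  {S : Type} [TopologicalSpace S] [ChartedSpace E S]

theorem contDiffAt_comp_chartAt_symm {W : Type*} [NormedAddCommGroup W] [NormedSpace ℝ W]
    {P : S → W} {U : Set S} (hU : IsOpen U) (hP : ContMDiffOn 𝓘(ℝ, E) 𝓘(ℝ, W) 2 P U) {s : S}
    (hs : s ∈ U) : ContDiffAt ℝ 2 (P ∘ (chartAt E s).symm) (chartAt E s s) := by
  have h1 := (contMDiffAt_iff.1 (hP.contMDiffAt (hU.mem_nhds hs))).2
  simpa [contDiffWithinAt_univ, chartAt_self_eq] using h1

theorem contDiffAt_chartAt_comp [IsManifold 𝓘(ℂ, E) ω S] {s : S} {f : ℂ → S} {z : ℂ}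
    (hf : ContMDiffAt 𝓘(ℂ) 𝓘(ℂ, E) ω f z) (hz : f z ∈ (chartAt E s).source) :
    ContDiffAt ℂ ω (fun y => chartAt E s (f y)) z := by
  have h1 : ContMDiffAt 𝓘(ℂ, E) 𝓘(ℂ, E) ω (chartAt E s) (f z) := by
    have := contMDiffAt_extChartAt' (I := 𝓘(ℂ, E)) (n := ω) hz
    simpa using this
  exact (h1.comp z hf).contDiffAt

/-- The chart derivative depends only on the point of the tangent bundle given by the velocity,
through `tangentMap`. Working in the total space avoids transport between the tangent spaces at `g
y` and `f z`. -/
theorem deriv_chartAt_comp_eq [IsManifold 𝓘(ℂ, E) ω S] {s : S} {f g : ℂ → S} {z y : ℂ}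
    (hf : ContMDiffAt 𝓘(ℂ) 𝓘(ℂ, E) ω f z) (hg : ContMDiffAt 𝓘(ℂ) 𝓘(ℂ, E) ω g y)
    (hz : f z ∈ (chartAt E s).source)
    (h : (⟨g y, mfderiv 𝓘(ℂ) 𝓘(ℂ, E) g y (1 : ℂ)⟩ : TangentBundle 𝓘(ℂ, E) S) =
      ⟨f z, mfderiv 𝓘(ℂ) 𝓘(ℂ, E) f z (1 : ℂ)⟩) :
    deriv (fun w => chartAt E s (g w)) y = deriv (fun w => chartAt E s (f w)) z := by
  have hgf : g y = f z := congrArg Bundle.TotalSpace.proj h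
  have key : ∀ (k : ℂ → S) (a : ℂ), ContMDiffAt 𝓘(ℂ) 𝓘(ℂ, E) ω k a →
      k a ∈ (chartAt E s).source → deriv (fun w => chartAt E s (k w)) a =
        ((tangentMap 𝓘(ℂ, E) 𝓘(ℂ, E) (chartAt E s)
          (⟨k a, mfderiv 𝓘(ℂ) 𝓘(ℂ, E) k a (1 : ℂ)⟩ : TangentBundle 𝓘(ℂ, E) S)).2 : E) := by
    intro k a hk ha
    have h1 : ContMDiffAt 𝓘(ℂ, E) 𝓘(ℂ, E) ω (chartAt E s) (k a) := by
      have := contMDiffAt_extChartAt' (I := 𝓘(ℂ, E)) (n := ω) ha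
      simpa using this
    have h2 := mfderiv_comp a (h1.mdifferentiableAt (by simp)) (hk.mdifferentiableAt (by simp))
    rw [← fderiv_apply_one_eq_deriv]
    change fderiv ℂ ((chartAt E s) ∘ k) a 1 = _
    rw [← mfderiv_eq_fderiv, h2]
    rfl
  rw [key g y hg (hgf ▸ hz), key f z hf hz, h]

end Charts

/-! ## Sections of hermitian Hilbert bundles -/

section BundleSections

variable {E : Type*} [NormedAddCommGroup E] [NormedSpace ℂ E]
  {S : Type} [TopologicalSpace S] [ChartedSpace E S] {F : HolSheafMod E S}

/-- An identification of the sections of `F` with the holomorphic sections of `B`. -/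
structure SectionModel (p : SheafMetric F) (B : HolHilbertBundle E S) (H : HermitianMetricC2 B) where
  /-- the section of `B` given by a section of `F` -/
  e : ∀ U : Opens S, Sec F.val U → ∀ s : U, B.Fib s
  range_e : ∀ U, Set.range (e U) = {σ | B.IsHolSection U σ}
  e_add : ∀ U (φ ψ : Sec F.val U) (s : U), e U (φ + ψ) s = e U φ s + e U ψ s
  e_res : ∀ (U V : Opens S) (hV : V ≤ U) (φ : Sec F.val U) (s : V),
    e V (Sec.res hV φ) s = e U φ ⟨s, hV s.2⟩
  fn_eq : ∀ U (φ : Sec F.val U) (s : U), (p.fn φ s : ℝ) = √(H.h s (e U φ s) (e U φ s)).re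

theorem IsSheafOfSections.nonempty_sectionModel {p : SheafMetric F} {B : HolHilbertBundle E S}
    {H : HermitianMetricC2 B} (h : IsSheafOfSections p B H) : Nonempty (SectionModel p B H) := by
  obtain ⟨e, -, h2, h3, -, h5, h6⟩ := h
  exact ⟨⟨e, h2, h3, h5, h6⟩⟩

/-- `P` is the matrix of the hermitian metric in the trivialization `i`. -/
def HermitianMetricC2.IsMatrix {B : HolHilbertBundle E S} (H : HermitianMetricC2 B) (i : B.ι)
    (P : S → (B.Model i →L[ℂ] B.Model i)) : Prop :=
  ∀ s : B.dom i, IsSelfAdjoint (P s) ∧ IsUnit (P s) ∧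
      ∀ w₁ w₂, H.h s ((B.triv i s).symm w₁) ((B.triv i s).symm w₂) = inner ℂ w₂ (P s w₁)

theorem HermitianMetricC2.IsMatrix.pos {B : HolHilbertBundle E S} {H : HermitianMetricC2 B}
    {i : B.ι} {P : S → (B.Model i →L[ℂ] B.Model i)} (hP : H.IsMatrix i P) {t : S}
    (ht : t ∈ B.dom i) {v : B.Model i} (hv : v ≠ 0) : 0 < opForm (P t) v := by
  have h1 := H.pos t ((B.triv i ⟨t, ht⟩).symm v) (by simpa using hv)
  rw [(hP ⟨t, ht⟩).2.2] at h1
  exact h1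

namespace SectionModel

variable {p : SheafMetric F} {B : HolHilbertBundle E S} {H : HermitianMetricC2 B}
  (M : SectionModel p B H)

theorem e_eq_zero {U : Opens S} {φ : Sec F.val U} {s : U} (h : p.fn φ s = 0) : M.e U φ s = 0 := by
  by_contra hne
  have h1 := M.fn_eq U φ s
  rw [h, NNReal.coe_zero] at h1
  exact (Real.sqrt_pos.2 (H.pos s _ hne)).ne h1

theorem fn_eq_zero_of_e {U : Opens S} {φ ψ : Sec F.val U} {s : U} (h : M.e U φ s = M.e U ψ s) :
    p.fn (φ - ψ) s = 0 := by
  have h1 := M.e_add U (φ - ψ) ψ s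
  rw [sub_add_cancel, h] at h1
  have h2 : M.e U (φ - ψ) s = 0 := by simpa using h1.symm
  have h3 : (H.h s (M.e U (φ - ψ) s) (M.e U (φ - ψ) s)).re = 0 := by
    obtain ⟨i, hi⟩ := B.cover s
    obtain ⟨P, -, hP⟩ := H.local_form i
    have h4 := (hP ⟨s, hi⟩).2.2 0 0
    rw [map_zero] at h4
    rw [h2, h4, inner_zero_left, Complex.zero_re]
  have h5 := M.fn_eq U (φ - ψ) s
  rw [h3, Real.sqrt_zero] at h5
  exact_mod_cast h5

/-- Two representatives differ near `s` by a section of size zero at `s`, and positive definiteness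
of the metric makes its value there zero. -/
theorem e_eq_of_cls_eq {U V : Opens S} {s : S} {hU : s ∈ U} {hV : s ∈ V} {φ : Sec F.val U}
    {ψ : Sec F.val V} (h : p.normed.cls s hU φ = p.normed.cls s hV ψ) :
    M.e U φ ⟨s, hU⟩ = M.e V ψ ⟨s, hV⟩ := by
  obtain ⟨W, hW, iU, iV, χ, e, hχ⟩ := p.exists_sub_of_cls_eq h
  have h1 := M.e_res _ _ iU φ ⟨s, hW⟩
  have h2 := M.e_res _ _ iV ψ ⟨s, hW⟩
  rw [e, M.e_add, M.e_eq_zero hχ, add_zero, h2] at h1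
  exact h1.symm

theorem fn_eq_sqrt {i : B.ι} {P : S → (B.Model i →L[ℂ] B.Model i)} (hP : H.IsMatrix i P)
    {U : Opens S} (φ : Sec F.val U) {t : S} (ht : t ∈ U) (hi : t ∈ B.dom i) :
    (p.fn φ ⟨t, ht⟩ : ℝ) = √(opForm (P t) (B.triv i ⟨t, hi⟩ (M.e U φ ⟨t, ht⟩))) := by
  have h1 := (hP ⟨t, hi⟩).2.2 (B.triv i ⟨t, hi⟩ (M.e U φ ⟨t, ht⟩))
    (B.triv i ⟨t, hi⟩ (M.e U φ ⟨t, ht⟩))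
  rw [LinearEquiv.symm_apply_apply] at h1
  rw [M.fn_eq, h1]
  rfl

/-- Sections with a given holomorphic representation in a trivialization. -/
theorem exists_section (i : B.ι) {U : Opens S} (hU : U ≤ B.dom i) {L : S → B.Model i}
    (hL : ContMDiffOn 𝓘(ℂ, E) 𝓘(ℂ, B.Model i) ω L U) :
    ∃ φ : Sec F.val U, ∀ (t : S) (ht : t ∈ U), B.triv i ⟨t, hU ht⟩ (M.e U φ ⟨t, ht⟩) = L t := by
  have hσ : B.IsHolSection U (fun t => (B.triv i ⟨t, hU t.2⟩).symm (L t)) := by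
    intro j
    obtain ⟨g, hg, hg'⟩ := B.holomorphic_transition i j
    refine ⟨fun y => g y (L y), ?_, fun s hs hj => hg' s (hU hs) hj (L s)⟩
    exact (hg.mono (Set.inter_subset_inter_left _ hU)).clm_apply (hL.mono Set.inter_subset_left)
  have : (fun t : U => (B.triv i ⟨t, hU t.2⟩).symm (L t)) ∈ Set.range (M.e U) := by
    rw [M.range_e]; exact hσ
  obtain ⟨φ, hφ⟩ := this
  refine ⟨φ, fun t ht => ?_⟩
  rw [hφ, LinearEquiv.apply_symm_apply]

theorem exists_differentiableAt_comp {i : B.ι} {U : Opens S} (φ : Sec F.val U) {g : ℂ → S} {a : ℂ}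
    (hg : ContMDiffAt 𝓘(ℂ) 𝓘(ℂ, E) ω g a) (hU : g a ∈ U) (hi : g a ∈ B.dom i) :
    ∃ Φ : ℂ → B.Model i, (∀ᶠ z in 𝓝 a, DifferentiableAt ℂ Φ z) ∧
      ∀ z (hz : g z ∈ U) (hz' : g z ∈ B.dom i),
        Φ z = B.triv i ⟨g z, hz'⟩ (M.e U φ ⟨g z, hz⟩) := by
  have hσ : B.IsHolSection U (M.e U φ) := by
    have : M.e U φ ∈ Set.range (M.e U) := ⟨φ, rfl⟩
    rwa [M.range_e] at this
  obtain ⟨f, hf, hf'⟩ := hσ i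
  refine ⟨f ∘ g, ?_, fun z hz hz' => hf' (g z) hz hz'⟩
  have h1 : ContMDiffAt 𝓘(ℂ, E) 𝓘(ℂ, B.Model i) ω f (g a) :=
    hf.contMDiffAt ((U.isOpen.inter (B.dom i).isOpen).mem_nhds ⟨hU, hi⟩)
  have h2 : ContDiffAt ℂ ω (f ∘ g) a := (h1.comp a hg).contDiffAt
  exact (h2.eventually (by simp)).mono fun z hz => hz.differentiableAt (by simp)

/-- All representatives of the class have value `v` at `f z`, and all competing discs have the
velocity of `f` at `z`. The bound of `le_lambdaOp_log_opForm` uses only these data, so it controls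
the whole infimum. The chart stays the one at `s`, so that `leviOp` can be compared along the disc.
-/
theorem griffiths_fibreMk_le [IsManifold 𝓘(ℂ, E) ω S] {i : B.ι}
    {P : S → (B.Model i →L[ℂ] B.Model i)} (hP : H.IsMatrix i P) {s : S} {f : ℂ → S} {z : ℂ}
    (hf : ContMDiffAt 𝓘(ℂ) 𝓘(ℂ, E) ω f z) (hz : f z ∈ (chartAt E s).source)
    (hi : f z ∈ B.dom i)
    (hT : ContDiffAt ℝ 2 (P ∘ (chartAt E s).symm) (chartAt E s (f z)))
    (hsa : ∀ᶠ y in 𝓝 (chartAt E s (f z)), IsSelfAdjoint ((P ∘ (chartAt E s).symm) y))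
    {U : Opens S} (hU : f z ∈ U) (φ : Sec F.val U) {v : B.Model i} (hv : v ≠ 0)
    (hφ : B.triv i ⟨f z, hi⟩ (M.e U φ ⟨f z, hU⟩) = v) {m : ℝ}
    (hm : m * opForm ((P ∘ (chartAt E s).symm) (chartAt E s (f z))) v ≤
      opForm (leviOp (P ∘ (chartAt E s).symm) (chartAt E s (f z))
        (deriv (fun y => chartAt E s (f y)) z)) v) :
    p.normed.griffiths (f z) (mfderiv 𝓘(ℂ) 𝓘(ℂ, E) f z (1 : ℂ)) (p.fibreMk (f z) hU φ) ≤
      ((-m : ℝ) : EReal) := by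
  set T : E → B.Model i →L[ℂ] B.Model i := P ∘ (chartAt E s).symm with hTdef
  have hTP : ∀ t ∈ (chartAt E s).source, T (chartAt E s t) = P t := fun t ht => by
    rw [hTdef, Function.comp_apply, (chartAt E s).left_inv ht]
  refine NormedSections.griffiths_le_neg _ fun W hW ψ _ hc g hg hgξ => ?_
  have hg0 : g 0 = f z := congrArg Bundle.TotalSpace.proj hgξ
  have hgs : g 0 ∈ (chartAt E s).source := hg0 ▸ hz
  have hgi : g 0 ∈ B.dom i := hg0 ▸ hi
  have hgW : g 0 ∈ W := hg0 ▸ hW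
  have hG := contDiffAt_chartAt_comp hg hgs
  have hGξ := deriv_chartAt_comp_eq hf hg hz hgξ
  obtain ⟨Φ, hΦd, hΦ⟩ := M.exists_differentiableAt_comp (i := i) ψ hg hgW hgi
  have hΦ0 : Φ 0 = v := by
    rw [hΦ 0 hgW hgi, ← hφ, ← M.e_eq_of_cls_eq hc]
    congr!
  have hnear : ∀ᶠ y in 𝓝 (0 : ℂ), g y ∈ W ∧ g y ∈ B.dom i ∧ g y ∈ (chartAt E s).source :=
    (hg.continuousAt.eventually (W.isOpen.mem_nhds hgW)).and
      ((hg.continuousAt.eventually ((B.dom i).isOpen.mem_nhds hgi)).and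
        (hg.continuousAt.eventually ((chartAt E s).open_source.mem_nhds hgs)))
  have hGd := (hG.differentiableAt (by simp)).hasDerivAt
  rw [hGξ] at hGd
  have hmain := le_lambdaOp_log_opForm (T := T) (x := chartAt E s (f z)) hT hsa
    (by rw [hTP _ hz]; exact (hP ⟨f z, hi⟩).2.1)
    (fun v hv => by rw [hTP _ hz]; exact hP.pos hi hv) hGd
    ((hG.eventually (by simp)).mono fun y hy => hy.differentiableAt (by simp))
    (by rw [hg0]) hΦd (by rw [hΦ0]; exact hv) (m := m) (by rw [hΦ0]; exact hm)
  rwa [lambdaOp_congr (u' := fun y => (1 / 2 : ℝ) * Real.log (opForm (T (chartAt E s (g y))) (Φ y)))]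
  filter_upwards [hnear] with y hy
  obtain ⟨h1, h2, h3⟩ := hy
  rw [Function.comp_apply, p.logSize_normed ψ h1, M.fn_eq_sqrt hP ψ h1 h2, ← hΦ y h1 h2, hTP _ h3,
    Real.log_sqrt]
  · ring
  · rcases eq_or_ne (Φ y) 0 with h | h
    · rw [h, opForm_zero]
    · exact (hP.pos h2 h).le

end SectionModel

end BundleSections

/-! ## The curvature of the sheaf of homomorphisms -/

section Homomorphisms

variable {E : Type*} [NormedAddCommGroup E] [NormedSpace ℂ E]
  {S : Type} [TopologicalSpace S] [ChartedSpace E S] {F F' : HolSheafMod E S}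

/-- The size of a section as a function on the whole space. -/
def SheafMetric.sizeExt {F : HolSheafMod E S} (p : SheafMetric F) {U : Opens S} (φ : Sec F.val U) :
    S → ℝ :=
  Function.extend Subtype.val (fun x : U => (p.fn φ x : ℝ)) 0

theorem SheafMetric.sizeExt_apply {F : HolSheafMod E S} (p : SheafMetric F) {U : Opens S}
    (φ : Sec F.val U) {y : S} (hy : y ∈ U) : p.sizeExt φ y = p.fn φ ⟨y, hy⟩ :=
  Subtype.val_injective.extend_apply (fun x : U => (p.fn φ x : ℝ)) 0 ⟨y, hy⟩

theorem continuousAt_extend_val {U : Opens S} {u : U → ℝ} {y : S} (hy : y ∈ U)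
    (hu : ContinuousAt u ⟨y, hy⟩) :
    ContinuousAt (Function.extend Subtype.val u 0 : S → ℝ) y := by
  have h : ContinuousAt ((Function.extend Subtype.val u 0 : S → ℝ) ∘ (Subtype.val : U → S))
      ⟨y, hy⟩ := by
    have e : (Function.extend Subtype.val u 0 : S → ℝ) ∘ (Subtype.val : U → S) = u :=
      funext fun a => Subtype.val_injective.extend_apply u 0 a
    rwa [e]
  exact (U.isOpenEmbedding'.continuousAt_iff (f := (Subtype.val : U → S)) (x := ⟨y, hy⟩)).1 h

theorem continuousAt_logSize_homMetric {p : SheafMetric F} {p' : SheafMetric F'} {U : Opens S}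
    {α : HomOn F F' U} (hα : (homMetric p p').mem U α) {y : S} (hy : y ∈ U)
    (h0 : homNorm p p' α ⟨y, hy⟩ ≠ 0) : ContinuousAt ((homMetric p p').logSize U α) y := by
  refine continuousAt_extend_val hy ?_
  have h1 : ContinuousAt (homNorm p p' α) ⟨y, hy⟩ := hα.2.continuousAt
  have h2 := (ENNReal.tendsto_toReal (hα.1 ⟨y, hy⟩)).comp h1.tendsto
  exact ContinuousAt.log h2 (ENNReal.toReal_ne_zero.2 ⟨h0, hα.1 _⟩)

theorem zero_le_lambdaOp_logSize_homMetric [IsManifold 𝓘(ℂ, E) ω S] {p : SheafMetric F}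
    {p' : SheafMetric F'} {B : HolHilbertBundle E S} {H : HermitianMetricC2 B}
    (M : SectionModel p B H)
    (hK : ∀ (s : S) (ξ : TangentSpace 𝓘(ℂ, E) s),
      (⨆ (v' : p'.normed.Fibre s) (_ : p'.normed.fibreNorm s v' ≠ 0),
        p'.normed.griffiths s ξ v') ≤
      ⨅ (v : p.normed.Fibre s) (_ : p.normed.fibreNorm s v ≠ 0), p.normed.griffiths s ξ v)
    {U : Opens S} {α : HomOn F F' U} (hα : (homMetric p p').mem U α) {f : ℂ → S}
    (hf : ContMDiffAt 𝓘(ℂ) 𝓘(ℂ, E) ω f 0) (hU : f 0 ∈ U) (h0 : homNorm p p' α ⟨f 0, hU⟩ ≠ 0) :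
    0 ≤ lambdaOp ((homMetric p p').logSize U α ∘ f) 0 := by
  set s := f 0 with hs
  obtain ⟨i, hi⟩ := B.cover s
  obtain ⟨P, hPd, hP⟩ := H.local_form i
  replace hP : H.IsMatrix i P := hP
  set χ := chartAt E s with hχ
  have hsχ : s ∈ χ.source := mem_chart_source E s
  set T : E → B.Model i →L[ℂ] B.Model i := P ∘ χ.symm with hTdef
  have hTP : ∀ t ∈ χ.source, T (χ t) = P t := fun t ht => by
    rw [hTdef, Function.comp_apply, χ.left_inv ht]
  set x := χ s with hx
  have hT : ContDiffAt ℝ 2 T x := contDiffAt_comp_chartAt_symm (B.dom i).isOpen hPd hi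
  have hsa : ∀ t ∈ χ.source, t ∈ B.dom i → ∀ᶠ y in 𝓝 (χ t), IsSelfAdjoint (T y) := by
    intro t ht hti
    have h1 : Tendsto χ.symm (𝓝 (χ t)) (𝓝 t) := by
      have := (χ.continuousAt_symm (χ.map_source ht)).tendsto
      rwa [χ.left_inv ht] at this
    exact (h1.eventually ((B.dom i).isOpen.mem_nhds hti)).mono fun y hy => (hP ⟨_, hy⟩).1
  set V₀ : Opens S := U ⊓ (B.dom i ⊓ ⟨χ.source, χ.open_source⟩) with hV₀
  have hV₀U : V₀ ≤ U := inf_le_left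
  have hV₀i : V₀ ≤ B.dom i := inf_le_right.trans inf_le_left
  have hV₀χ : ∀ t ∈ V₀, t ∈ χ.source := fun t ht => ht.2.2
  have hsV₀ : s ∈ V₀ := ⟨hU, hi, hsχ⟩
  set G : ℂ → E := fun z => χ (f z) with hG
  have hGd : ContDiffAt ℂ ω G 0 := contDiffAt_chartAt_comp hf hsχ
  have hχd : ContMDiffOn 𝓘(ℂ, E) 𝓘(ℂ, E) ω χ V₀ := by
    intro t ht
    have := contMDiffAt_extChartAt' (I := 𝓘(ℂ, E)) (n := ω) (hV₀χ t ht)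
    exact ContMDiffAt.contMDiffWithinAt (by simpa using this)
  -- The normalized test sections; they are holomorphic because the connection form at `x` is
  -- complex linear.
  have hsec : ∀ v : B.Model i, ∃ φ : Sec F.val V₀, ∀ (t : S) (ht : t ∈ V₀),
      B.triv i ⟨t, hV₀i ht⟩ (M.e V₀ φ ⟨t, ht⟩) = v - connForm T x (χ t - x) v := by
    intro v
    refine M.exists_section i hV₀i ?_
    have h1 : ContDiff ℂ ω (fun y : E => v - connForm T x (y - x) v) := by fun_prop
    exact h1.contMDiff.comp_contMDiffOn hχd
  -- Sections constant in the trivialization, which test the curvature of `F` at the points `f z`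
  -- with one fixed vector `v₁`.
  have hconst : ∀ v : B.Model i, ∃ φ : Sec F.val V₀, ∀ (t : S) (ht : t ∈ V₀),
      B.triv i ⟨t, hV₀i ht⟩ (M.e V₀ φ ⟨t, ht⟩) = v := fun v =>
    M.exists_section i hV₀i contMDiffOn_const
  choose φ hφ using hsec
  have hfV₀ : ∀ᶠ z in 𝓝 (0 : ℂ), f z ∈ V₀ := hf.continuousAt.eventually (V₀.isOpen.mem_nhds hsV₀)
  have hfω : ∀ᶠ z in 𝓝 (0 : ℂ), ContMDiffAt 𝓘(ℂ) 𝓘(ℂ, E) ω f z :=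
    (contMDiffAt_iff_contMDiffAt_nhds (by simp)).1 hf
  have hpos_near : ∀ᶠ z in 𝓝 (0 : ℂ), ∃ hz : f z ∈ U, homNorm p p' α ⟨f z, hz⟩ ≠ 0 := by
    have h1 : ∀ᶠ y in 𝓝 (⟨s, hU⟩ : U), homNorm p p' α y ≠ 0 :=
      hα.2.continuousAt.eventually_ne h0
    have h2 : ∀ᶠ y in 𝓝 s, ∃ hy : y ∈ U, homNorm p p' α ⟨y, hy⟩ ≠ 0 := by
      rw [← U.isOpenEmbedding'.map_nhds_eq ⟨s, hU⟩, eventually_map]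
      exact h1.mono fun y hy => ⟨y.2, hy⟩
    exact hf.continuousAt.eventually h2
  have hxu : IsUnit (T x) := by rw [hTP s hsχ]; exact (hP ⟨s, hi⟩).2.1
  have hxpos : ∀ v, v ≠ 0 → 0 < opForm (T x) v := fun v hv => by
    rw [hTP s hsχ]; exact hP.pos hi hv
  set w : B.Model i → ℂ → ℝ := fun v z => p'.sizeExt (α.app V₀ hV₀U (φ v)) (f z) with hw
  have hws : ∀ v z (hz : f z ∈ V₀), w v z = p'.fn (α.app V₀ hV₀U (φ v)) ⟨f z, hz⟩ :=
    fun v z hz => p'.sizeExt_apply _ hz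
  refine zero_le_lambdaOp_of_family (T := T) (x := x) (G := G) (w := w) hT (hsa s hsχ hi) hxu hxpos
    (hGd.of_le (by simp)) rfl ?_ ?_ ?_ ?_
  · filter_upwards [hpos_near, hfω] with z hz hz'
    exact (continuousAt_logSize_homMetric hα hz.1 hz.2).comp hz'.continuousAt
  · filter_upwards [hpos_near, hfω, hfV₀] with z hz hz' hzV v
    refine ⟨ContinuousAt.comp (continuousAt_extend_val hzV ?_) hz'.continuousAt, ?_⟩
    · exact (NNReal.continuous_coe.comp (p'.fn (α.app V₀ hV₀U (φ v))).continuous).continuousAt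
    · obtain ⟨hzU, hz0⟩ := hz
      have h1 := fn_app_le_homNorm_mul p p' α (hα.1 ⟨f z, hzU⟩) hV₀U hzV (φ v)
      rw [M.fn_eq_sqrt hP (φ v) hzV (hV₀i hzV), hφ v (f z) hzV] at h1
      rw [hws v z hzV, Function.comp_apply, logSize_homMetric p p' α hzU,
        Real.exp_log (ENNReal.toReal_pos hz0 (hα.1 _)), hTP _ (hV₀χ _ hzV)]
      exact h1
  · intro m v₁ hv₁ hm
    obtain ⟨φ₁, hφ₁⟩ := hconst v₁
    have hTev : ∀ᶠ z in 𝓝 (0 : ℂ), ContDiffAt ℝ 2 T (G z) :=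
      hGd.continuousAt.eventually (hT.eventually (by simp))
    filter_upwards [hm, hfω, hfV₀, hTev] with z hmz hfz hzV hTz v hwv
    have hup := M.griffiths_fibreMk_le hP hfz (hV₀χ _ hzV) (hV₀i hzV) hTz
      (hsa _ (hV₀χ _ hzV) (hV₀i hzV)) hzV φ₁ hv₁ (hφ₁ _ hzV) hmz
    have hn1 : p.normed.fibreNorm (f z) (p.fibreMk (f z) hzV φ₁) ≠ 0 := by
      rw [p.fibreNorm_fibreMk]
      have : 0 < (p.fn φ₁ ⟨f z, hzV⟩ : ℝ) := by
        rw [M.fn_eq_sqrt hP φ₁ hzV (hV₀i hzV), hφ₁ _ hzV]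
        exact Real.sqrt_pos.2 (hP.pos (hV₀i hzV) hv₁)
      exact ENNReal.coe_ne_zero.2 (NNReal.coe_pos.1 this).ne'
    have hn2 : p'.normed.fibreNorm (f z) (p'.fibreMk (f z) hzV (α.app V₀ hV₀U (φ v))) ≠ 0 := by
      rw [p'.fibreNorm_fibreMk]
      rw [hws v z hzV] at hwv
      exact ENNReal.coe_ne_zero.2 (NNReal.coe_pos.1 hwv).ne'
    have hinf : (⨅ (v : p.normed.Fibre (f z)) (_ : p.normed.fibreNorm (f z) v ≠ 0),
        p.normed.griffiths (f z) (mfderiv 𝓘(ℂ) 𝓘(ℂ, E) f z (1 : ℂ)) v) ≤ ((-m : ℝ) : EReal) :=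
      iInf_le_of_le _ (iInf_le_of_le hn1 hup)
    have hle : p'.normed.griffiths (f z) (mfderiv 𝓘(ℂ) 𝓘(ℂ, E) f z (1 : ℂ))
        (p'.fibreMk (f z) hzV (α.app V₀ hV₀U (φ v))) ≤ ((-m : ℝ) : EReal) :=
      (le_iSup₂ (f := fun (v' : p'.normed.Fibre (f z)) (_ : p'.normed.fibreNorm (f z) v' ≠ 0) =>
        p'.normed.griffiths (f z) (mfderiv 𝓘(ℂ) 𝓘(ℂ, E) f z (1 : ℂ)) v') _ hn2).trans
        ((hK (f z) _).trans hinf)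
    -- The curvature hypothesis at `f z` concerns discs centred there; the translate `y ↦ f (z + y)`
    -- is one, with the velocity of `f` at `z`.
    have hshift : ContMDiffAt 𝓘(ℂ) 𝓘(ℂ) ω (fun y : ℂ => z + y) 0 :=
      (contDiff_const.add contDiff_id).contMDiff.contMDiffAt
    have hfz' : ContMDiffAt 𝓘(ℂ) 𝓘(ℂ, E) ω f (z + 0) := by rwa [add_zero]
    have hg : ContMDiffAt 𝓘(ℂ) 𝓘(ℂ, E) ω (fun y => f (z + y)) 0 := hfz'.comp 0 hshift
    have hgξ : (⟨f (z + 0), mfderiv 𝓘(ℂ) 𝓘(ℂ, E) (fun y => f (z + y)) 0 (1 : ℂ)⟩ :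
        TangentBundle 𝓘(ℂ, E) S) = ⟨f z, mfderiv 𝓘(ℂ) 𝓘(ℂ, E) f z (1 : ℂ)⟩ := by
      have h1 : mfderiv 𝓘(ℂ) 𝓘(ℂ, E) (fun y => f (z + y)) 0 (1 : ℂ) =
          mfderiv 𝓘(ℂ) 𝓘(ℂ, E) f (z + 0) (1 : ℂ) := by
        have h2 := mfderiv_comp (0 : ℂ) (hfz'.mdifferentiableAt (by simp))
          (hshift.mdifferentiableAt (by simp))
        have h3 : mfderiv 𝓘(ℂ) 𝓘(ℂ) (fun y : ℂ => z + y) 0 (1 : ℂ) = (1 : ℂ) := by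
          rw [mfderiv_eq_fderiv, fderiv_const_add, fderiv_fun_id]
          rfl
        change mfderiv 𝓘(ℂ) 𝓘(ℂ, E) (f ∘ fun y : ℂ => z + y) 0 (1 : ℂ) = _
        rw [h2]
        exact congrArg (mfderiv 𝓘(ℂ) 𝓘(ℂ, E) f (z + 0)) h3
      rw [h1, add_zero]
    have hfin := NormedSections.le_lambdaOp_of_griffiths_le p'.normed hle (hs := hzV)
      (φ := α.app V₀ hV₀U (φ v)) trivial rfl hg hgξ
    have h4 := lambdaOp_comp_add (p'.normed.logSize V₀ (α.app V₀ hV₀U (φ v)) ∘ f) z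
    rw [← lambdaOp_congr (u := p'.normed.logSize V₀ (α.app V₀ hV₀U (φ v)) ∘ f), ← h4]
    · exact hfin
    · filter_upwards [hfz.continuousAt.eventually (V₀.isOpen.mem_nhds hzV)] with y hy
      rw [Function.comp_apply, p'.logSize_normed _ hy, hws v y hy]
  · intro η hη
    set N := homNorm p p' α ⟨s, hU⟩ with hN
    have hNtop : N ≠ ⊤ := hα.1 _
    have hNpos : 0 < N.toReal := ENNReal.toReal_pos h0 hNtop
    -- The constant `e^{-η}‖α‖(s)` lies strictly below the norm, so some section `ψ` violates the
    -- bound with it; the value of `ψ` at `s` is the desired vector.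
    obtain ⟨b, hb⟩ : ∃ b : ℝ≥0, (b : ℝ) = Real.exp (-η) * N.toReal :=
      ⟨⟨_, by positivity⟩, rfl⟩
    have hbN : (b : ℝ≥0∞) < N := by
      rw [← ENNReal.coe_toNNReal hNtop, ENNReal.coe_lt_coe, ← NNReal.coe_lt_coe, hb]
      have : Real.exp (-η) < 1 := Real.exp_lt_one_iff.2 (by linarith)
      calc _ < 1 * N.toReal := by gcongr
        _ = _ := one_mul _
    obtain ⟨V, hV, hsV, ψ, hψ⟩ := exists_lt_fn_app p p' α hbN
    set v := B.triv i ⟨s, hi⟩ (M.e V ψ ⟨s, hsV⟩) with hv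
    have hpψ := M.fn_eq_sqrt hP ψ hsV hi
    rw [← hv] at hpψ
    refine ⟨v, ?_, ?_⟩
    · rintro hv0
      rw [hv0, opForm_zero, Real.sqrt_zero] at hpψ
      have h1 := fn_app_le_homNorm_mul p p' α hNtop hV hsV ψ
      rw [hpψ, mul_zero] at h1
      rw [hpψ, mul_zero] at hψ
      exact absurd hψ (not_lt.2 h1)
    · rw [Function.comp_apply, logSize_homMetric p p' α hU, sub_eq_add_neg, Real.exp_add,
        Real.exp_log hNpos, mul_comm N.toReal, ← hb, hTP s hsχ, ← hpψ, hws v 0 hsV₀]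
      refine hψ.le.trans ?_
      have hW : s ∈ V ⊓ V₀ := ⟨hsV, hsV₀⟩
      -- The correction term of `φ v` vanishes at `s`, so `ψ` and `φ v` agree there and their images
      -- under `α` have comparable size at `s`.
      have he : M.e (V ⊓ V₀) (Sec.res inf_le_left ψ) ⟨s, hW⟩ =
          M.e (V ⊓ V₀) (Sec.res inf_le_right (φ v)) ⟨s, hW⟩ := by
        rw [M.e_res, M.e_res]
        apply (B.triv i ⟨s, hi⟩).injective
        rw [hφ v s hsV₀, ← hv, sub_self, map_zero, zero_apply, sub_zero]
      have h2 := fn_app_le_of_sub p p' α hNtop (inf_le_left.trans hV) hW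
        (φ := Sec.res (inf_le_left : V ⊓ V₀ ≤ V) ψ)
        (ψ := Sec.res (inf_le_right : V ⊓ V₀ ≤ V₀) (φ v)) (add_sub_cancel _ _).symm
        (M.fn_eq_zero_of_e he)
      rw [α.app_res hV inf_le_left ψ] at h2
      have h3 := α.app_res hV₀U (inf_le_right : V ⊓ V₀ ≤ V₀) (φ v)
      rw [h3, p'.fn_res, p'.fn_res] at h2
      exact_mod_cast h2

end Homomorphisms

end

theorem corollary2p5 {E : Type*} [NormedAddCommGroup E] [NormedSpace ℂ E] [FiniteDimensional ℂ E]
    {S : Type} [TopologicalSpace S] [T2Space S] [ChartedSpace E S] [IsManifold 𝓘(ℂ, E) ω S]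
    {F F' : HolSheafMod E S} (p : SheafMetric F) (p' : SheafMetric F')
    (B : HolHilbertBundle E S) (H : HermitianMetricC2 B) (hF : IsSheafOfSections p B H)
    (hK : ∀ (s : S) (ξ : TangentSpace 𝓘(ℂ, E) s),
      (⨆ (v' : p'.normed.Fibre s) (_ : p'.normed.fibreNorm s v' ≠ 0),
        p'.normed.griffiths s ξ v') ≤
      ⨅ (v : p.normed.Fibre s) (_ : p.normed.fibreNorm s v ≠ 0), p.normed.griffiths s ξ v) :
    (homMetric p p').SeminegativeCurvature := by
  obtain ⟨M⟩ := hF.nonempty_sectionModel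
  intro s ξ v hv
  have hle : (homMetric p p').griffiths s ξ v ≤ ((-0 : ℝ) : EReal) := by
    refine NormedSections.griffiths_le_neg _ fun U hs α hα hc f hf hfξ => ?_
    have hf0 : f 0 = s := congrArg Bundle.TotalSpace.proj hfξ
    -- `fibreNorm` is an infimum over all representatives, so its not vanishing forces `‖α‖(s) ≠ 0`
    -- for each of them.
    have h0 : homNorm p p' (U := U) α ⟨s, hs⟩ ≠ 0 := by
      intro h
      refine hv (le_antisymm ?_ zero_le)
      rw [← h]
      exact iInf_le_of_le U (iInf_le_of_le hs (iInf_le_of_le α (iInf_le_of_le hα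
        (iInf_le_of_le hc le_rfl))))
    subst hf0
    rw [mul_zero, EReal.coe_zero]
    exact zero_le_lambdaOp_logSize_homMetric M hK hα hf hs h0
  rwa [neg_zero, EReal.coe_zero] at hle
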